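/- Let $\mathbb{O}=\mathbb{H}+\ell\mathbb{H}\cong\mathbb{R}^8$ be the algebra of octonions, with conjugation $x\mapsto x^c$ and $\mathrm{im}(x)=\frac12(x-x^c)$, let $\mathbb{S}=\{J\in\mathbb{O}: J^2=-1\}$, and for $J\in\mathbb{S}$ let $\mathbb{C}_J=\mathbb{R}+J\mathbb{R}$, with orthogonal complement $\mathbb{C}_J^\perp$. Let $D\subseteq\mathbb{C}$ be non-empty, open and invariant under complex conjugation, and let $\Omega=\{\alpha+\beta J:\alpha+i\beta\in D,\ J\in\mathbb{S}\}$. A stem function $F=F_1+\imath F_2:D\to\mathbb{O}\otimes\mathbb{C}$ is a function with $F(\bar z)=\overline{F(z)}$; it induces the function $\Omega\to\mathbb{O}$, $\alpha+\beta J\mapsto F_1(\alpha+i\beta)+JF_2(\alpha+i\beta)$. A function $g:\Omega\to\mathbb{O}$ is slice regular if it is induced by a stem function $F$ of class $C^1$ with $\partial F/\partial\bar z=0$, slice preserving if it is induced by a stem function with $F_1,F_2$ real-valued, and slice constant if $g|_{\Omega\cap\mathbb{C}_J}$ is locally constant for every $J\in\mathbb{S}$. For $g$ slice regular, $g'_c$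 denotes the function induced by $\partial F/\partial z$, and $g'_s(x)=\frac12\mathrm{im}(x)^{-1}(g(x)-g(x^c))$ for $x\in\Omega\setminus\mathbb{R}$. Write $(x,y,z)=(xy)z-x(yz)$. The standard almost-complex structure on $\mathbb{O}\setminus\mathbb{R}$ is $\mathbb{J}_{x}(v)=\frac{\mathrm{im}(x)}{|\mathrm{im}(x)|}v$. Let $g:\Omega\to\mathbb{O}$ be a slice regular function that is not slice constant, and let $U$ be an open subset of $\Omega\setminus\mathbb{R}$ such that $f:=g|_U$ is injective; write $f'_c,f'_s$ for the restrictions of $g'_c,g'_s$ to $U$. Then: 1. For every $x_0\in U$ the real differential $df_{x_0}$ is invertible; hence the push-forward $\mathbb{J}^f_{f(x_0)}:=df_{x_0}\circ\mathbb{J}_{x_0}\circ df_{x_0}^{-1}$ is well defined on $f(U)$. 2. If $x_0=\alpha+\beta J\in U$ with $J\in\mathbb{S}$, $\alpha\in\mathbb{R}$ and $\beta>0$, then $f'_s(x_0)\neq0$, $\mathbb{O}=\mathbb{C}_J\,f'_c(x_0)\oplus\mathbb{C}_J^\perp\,f'_s(x_0)$, and $$\mathbb{J}^f_{f(x_0)}(p+q)=Jp+\bigl(J(q\,f'_s(x_0)^{-1})\bigr)f'_s(x_0)$$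 for all $p\in\mathbb{C}_J\,f'_c(x_0)$ and $q\in\mathbb{C}_J^\perp\,f'_s(x_0)$. 3. $f(U)$ is open, $\mathbb{J}^f$ is a (smooth) almost-complex structure on $f(U)$, and $f$ is a holomorphic map between the almost-complex manifolds $(U,\mathbb{J})$ and $(f(U),\mathbb{J}^f)$. 4. $\mathbb{J}^f$ is orthogonal if, and only if, $(x_0,f'_c(x_0),f'_s(x_0))=0$ for all $x_0\in U$. This is always the case if $g(\Omega\cap\mathbb{C}_J)\subseteq\mathbb{C}_J$ for some $J\in\mathbb{S}$. 5. If $g$ is slice preserving, then $f(U)\cap\mathbb{R}=\emptyset$ and, for all $x_0\in U$, $f'_s(x_0)$ is a non-zero real number and $\mathbb{J}^f_{f(x_0)}=\mathrm{sgn}(f'_s(x_0))\,\mathbb{J}_{f(x_0)}$; thus $\mathbb{J}^f=\mathbb{J}$ on $f(U)$ exactly when $f'_s>0$ on $U$. Conversely, if $U=\Omega\setminus\mathbb{R}$, $f(U)\cap\mathbb{R}=\emptyset$ and $\mathbb{J}^f_y\in\{\mathbb{J}_y,-\mathbb{J}_y\}$ for all $y\in f(U)$ (in particular if $\mathbb{J}^f=\mathbb{J}$),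 then $g$ is slice preserving. -/

import Mathlib

open scoped Quaternion ContDiff Topology

/-- The octonions as pairs of quaternions: the pair `(a, b)` stands for `a + ℓ b`.
The `L²` product gives the Euclidean structure of `ℝ⁸`. -/
def Octonion : Type := WithLp 2 (ℍ[ℝ] × ℍ[ℝ])

namespace Octonion

noncomputable section

instance : NormedAddCommGroup Octonion :=
  inferInstanceAs (NormedAddCommGroup (WithLp 2 (ℍ[ℝ] × ℍ[ℝ])))

instance : InnerProductSpace ℝ Octonion :=
  inferInstanceAs (InnerProductSpace ℝ (WithLp 2 (ℍ[ℝ] × ℍ[ℝ])))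

instance : FiniteDimensional ℝ Octonion :=
  inferInstanceAs (FiniteDimensional ℝ (WithLp 2 (ℍ[ℝ] × ℍ[ℝ])))

/-- The octonion `a + ℓ b`. -/
def mk (a b : ℍ[ℝ]) : Octonion := WithLp.toLp 2 (a, b)

/-- The quaternion `a` in `a + ℓ b`. -/
def fst (x : Octonion) : ℍ[ℝ] := (WithLp.ofLp x).1

/-- The quaternion `b` in `a + ℓ b`. -/
def snd (x : Octonion) : ℍ[ℝ] := (WithLp.ofLp x).2

@[ext] theorem ext {x y : Octonion} (h1 : x.fst = y.fst) (h2 : x.snd = y.snd) : x = y :=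
  WithLp.ofLp_injective 2 (Prod.ext h1 h2)

@[simp] theorem fst_mk (a b : ℍ[ℝ]) : (mk a b).fst = a := rfl
@[simp] theorem snd_mk (a b : ℍ[ℝ]) : (mk a b).snd = b := rfl
@[simp] theorem fst_zero : (0 : Octonion).fst = 0 := rfl
@[simp] theorem snd_zero : (0 : Octonion).snd = 0 := rfl
@[simp] theorem fst_add (x y : Octonion) : (x + y).fst = x.fst + y.fst := rfl
@[simp] theorem snd_add (x y : Octonion) : (x + y).snd = x.snd + y.snd := rfl
@[simp] theorem fst_neg (x : Octonion) : (-x).fst = -x.fst := rfl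
@[simp] theorem snd_neg (x : Octonion) : (-x).snd = -x.snd := rfl
@[simp] theorem fst_sub (x y : Octonion) : (x - y).fst = x.fst - y.fst := rfl
@[simp] theorem snd_sub (x y : Octonion) : (x - y).snd = x.snd - y.snd := rfl
@[simp] theorem fst_smul (r : ℝ) (x : Octonion) : (r • x).fst = r • x.fst := rfl
@[simp] theorem snd_smul (r : ℝ) (x : Octonion) : (r • x).snd = r • x.snd := rfl

instance : One Octonion := ⟨mk 1 0⟩

/-- Cayley–Dickson product `(a + ℓ b)(c + ℓ d) = a c - d b^c + ℓ (a^c d + c b)`. -/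
instance : Mul Octonion :=
  ⟨fun x y => mk (x.fst * y.fst - y.snd * star x.snd) (star x.fst * y.snd + y.fst * x.snd)⟩

@[simp] theorem fst_one : (1 : Octonion).fst = 1 := rfl
@[simp] theorem snd_one : (1 : Octonion).snd = 0 := rfl
@[simp] theorem fst_mul (x y : Octonion) :
    (x * y).fst = x.fst * y.fst - y.snd * star x.snd := rfl
@[simp] theorem snd_mul (x y : Octonion) :
    (x * y).snd = star x.fst * y.snd + y.fst * x.snd := rfl

instance : NonAssocRing Octonion :=
  { (inferInstance : AddCommGroup Octonion) with
    mul := (· * ·)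
    one := 1
    left_distrib := fun a b c => by
      ext1 <;> simp [mul_add, add_mul] <;> abel
    right_distrib := fun a b c => by
      ext1 <;> simp [mul_add, add_mul] <;> abel
    zero_mul := fun a => by ext1 <;> simp
    mul_zero := fun a => by ext1 <;> simp
    one_mul := fun a => by ext1 <;> simp
    mul_one := fun a => by ext1 <;> simp }

instance : IsScalarTower ℝ Octonion Octonion :=
  ⟨fun r x y => by
    simp only [smul_eq_mul]
    ext1 <;> simp [smul_sub, smul_add]⟩

instance : SMulCommClass ℝ Octonion Octonion :=
  ⟨fun r x y => by
    simp only [smul_eq_mul]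
    ext1 <;> simp [smul_sub, smul_add]⟩

/-- The conjugation `x ↦ x^c`. -/
def conj (x : Octonion) : Octonion := mk (star x.fst) (-x.snd)

/-- The inverse `x⁻¹ = n(x)⁻¹ x^c`, where `n(x) = ‖x‖²` (and `0⁻¹ = 0`). -/
instance : Inv Octonion := ⟨fun x => (‖x‖ ^ 2)⁻¹ • conj x⟩

/-- The real axis `ℝ ⊆ 𝕆`. -/
def realAxis : Submodule ℝ Octonion := Submodule.span ℝ {1}

/-- The imaginary part `(x - x^c) / 2`. -/
def im (x : Octonion) : Octonion := (1 / 2 : ℝ) • (x - conj x)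

/-- The sphere `𝕊` of imaginary units. -/
def imaginaryUnits : Set Octonion := {J | J * J = -1}

/-- `φ_J : ℂ → 𝕆`, `α + i β ↦ α + β J`. -/
def embed (J : Octonion) (z : ℂ) : Octonion := z.re • (1 : Octonion) + z.im • J

/-- The slice `ℂ_J = ℝ + J ℝ`. -/
def slice (J : Octonion) : Submodule ℝ Octonion := Submodule.span ℝ {1, J}

/-- The circularization `Ω_D` of `D ⊆ ℂ`. -/
def circularization (D : Set ℂ) : Set Octonion :=
  {x | ∃ J ∈ imaginaryUnits, ∃ z ∈ D, x = embed J z}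

/-! ### Stem functions and slice functions

The complexification `𝕆 ⊗ ℂ` is the space of pairs `(x, y)`, standing for `x + ı y`. -/

/-- `φ_J : 𝕆 ⊗ ℂ → 𝕆`, `x + ı y ↦ x + J y`. -/
def embedC (J : Octonion) (w : Octonion × Octonion) : Octonion := w.1 + J * w.2

/-- Multiplication by `ı` on `𝕆 ⊗ ℂ`. -/
def mulI (w : Octonion × Octonion) : Octonion × Octonion := (-w.2, w.1)

/-- `D` is a non-empty open subset of `ℂ` that is preserved by complex conjugation. -/
structure IsAdmissible (D : Set ℂ) : Prop where
  isOpen : IsOpen D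
  nonempty : D.Nonempty
  conj_mem : ∀ z ∈ D, (starRingEnd ℂ) z ∈ D

/-- `F` is a stem function on `D`: `F (z̄)` is the complex conjugate of `F z`. -/
def IsStem (D : Set ℂ) (F : ℂ → Octonion × Octonion) : Prop :=
  ∀ z ∈ D, F ((starRingEnd ℂ) z) = ((F z).1, -(F z).2)

/-- The slice function `f` on `Ω_D` is induced by `F`: `f ∘ φ_J = φ_J ∘ F` on `D` for all `J`. -/
def Induces (D : Set ℂ) (F : ℂ → Octonion × Octonion) (f : Octonion → Octonion) : Prop :=
  ∀ J ∈ imaginaryUnits, ∀ z ∈ D, f (embed J z) = embedC J (F z)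

/-- `∂F/∂z̄ = (∂F/∂α + ı ∂F/∂β) / 2`. -/
def dbar (F : ℂ → Octonion × Octonion) (z : ℂ) : Octonion × Octonion :=
  (1 / 2 : ℝ) • (fderiv ℝ F z 1 + mulI (fderiv ℝ F z Complex.I))

/-- `∂F/∂z = (∂F/∂α - ı ∂F/∂β) / 2`. -/
def dz (F : ℂ → Octonion × Octonion) (z : ℂ) : Octonion × Octonion :=
  (1 / 2 : ℝ) • (fderiv ℝ F z 1 - mulI (fderiv ℝ F z Complex.I))

/-- `F` is a holomorphic stem function on `D`. -/
structure IsHolomorphicStem (D : Set ℂ) (F : ℂ → Octonion × Octonion) : Prop where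
  isStem : IsStem D F
  contDiffOn : ContDiffOn ℝ 1 F D
  dbar_eq_zero : ∀ z ∈ D, dbar F z = 0

/-- `f` is slice regular on `Ω_D`: it is induced by a holomorphic stem function on `D`. -/
def IsSliceRegular (D : Set ℂ) (f : Octonion → Octonion) : Prop :=
  ∃ F, IsHolomorphicStem D F ∧ Induces D F f

/-- `f` is a slice preserving slice function on `Ω_D`: it is induced by a stem function with
values in `ℝ + ı ℝ`. -/
def IsSlicePreserving (D : Set ℂ) (f : Octonion → Octonion) : Prop :=
  ∃ F, IsStem D F ∧ Induces D F f ∧ ∀ z ∈ D, (F z).1 ∈ realAxis ∧ (F z).2 ∈ realAxis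

/-- `f` is slice constant on `Ω_D`: its restriction to each `Ω_D ∩ ℂ_J` is locally constant. -/
def IsSliceConstant (D : Set ℂ) (f : Octonion → Octonion) : Prop :=
  ∀ J ∈ imaginaryUnits, ∀ x ∈ circularization D ∩ slice J,
    ∀ᶠ y in 𝓝[circularization D ∩ slice J] x, f y = f x

/-- The spherical derivative `f'_s(x) = (1/2) im(x)⁻¹ (f(x) - f(x^c))`, for `x` not real. -/
def sphericalDeriv (f : Octonion → Octonion) (x : Octonion) : Octonion :=
  (1 / 2 : ℝ) • ((im x)⁻¹ * (f x - f (conj x)))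

/-- The value at `x` of the slice function induced by `F`, computed with
`x = φ_J (α + i β)`, `α = re x`, `β = |im x|`, `J = im x / |im x|`
(at real `x`, stem functions have vanishing second component, and `J` plays no role). -/
def ofStem (F : ℂ → Octonion × Octonion) (x : Octonion) : Octonion :=
  embedC (‖im x‖⁻¹ • im x) (F ⟨x.fst.re, ‖im x‖⟩)

open Classical in
/-- The slice derivative `f'_c` of a slice regular function `f` on `Ω_D`: the slice function
induced by `∂F/∂z`, where `F` is the (on `D` unique) stem function that induces `f`. -/
def sliceDeriv (D : Set ℂ) (f : Octonion → Octonion) : Octonion → Octonion :=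
  if h : IsSliceRegular D f then ofStem (dz h.choose) else 0

/-! ### Almost-complex structures on open subsets of `𝕆`

Tangent spaces of open subsets of `𝕆` are identified with `𝕆`. -/

/-- `𝒥` is a (smooth) almost-complex structure on the open set `V`. -/
structure IsAlmostComplexStructure (V : Set Octonion)
    (𝒥 : Octonion → Octonion →L[ℝ] Octonion) : Prop where
  isOpen : IsOpen V
  smooth : ContDiffOn ℝ ∞ 𝒥 V
  sq : ∀ y ∈ V, ∀ v, 𝒥 y (𝒥 y v) = -v

/-- `𝒥` is orthogonal at all points of `V`. -/
def IsOrthogonal (V : Set Octonion) (𝒥 : Octonion → Octonion →L[ℝ] Octonion) : Prop :=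
  ∀ y ∈ V, ∀ u v, inner ℝ (𝒥 y u) (𝒥 y v) = inner ℝ u v

/-- `f` is a holomorphic map from `(U, 𝒥₁)` to `(V, 𝒥₂)`. -/
structure IsHolomorphicMap (U V : Set Octonion) (𝒥₁ 𝒥₂ : Octonion → Octonion →L[ℝ] Octonion)
    (f : Octonion → Octonion) : Prop where
  mapsTo : Set.MapsTo f U V
  smooth : ContDiffOn ℝ ∞ f U
  comm : ∀ x ∈ U, ∀ v, fderiv ℝ f x (𝒥₁ x v) = 𝒥₂ (f x) (fderiv ℝ f x v)

/-- The standard almost-complex structure of `𝕆 ∖ ℝ`: left multiplication by `im x / |im x|`. -/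
def stdJ (x : Octonion) : Octonion →L[ℝ] Octonion :=
  LinearMap.toContinuousLinearMap (LinearMap.mulLeft ℝ (‖im x‖⁻¹ • im x))

/-- The push-forward of the standard structure through `f` restricted to `U`: at `y = f x` with
`x ∈ U` it is `df_x ∘ 𝕁_x ∘ df_x⁻¹`. It is meaningful if `f` is injective on `U` and `df_x`
is invertible at each `x ∈ U`. -/
def pushForward (f : Octonion → Octonion) (U : Set Octonion) (y : Octonion) :
    Octonion →L[ℝ] Octonion :=
  let x := Function.invFunOn f U y
  (fderiv ℝ f x).comp ((stdJ x).comp (fderiv ℝ f x).inverse)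

end

end Octonion

open Octonion

namespace Octonion

/-! ### Algebra of the octonions -/

/-! Write x = α + βJ near a point of U, so that g(x) = F₁ + J F₂ at z = α + iβ. Along `slice J` only
z varies, and the Cauchy-Riemann equations make dg right multiplication by a = g'_c(x). Orthogonally
to the slice only J varies, and dg is right multiplication by b = g'_s(x) = β⁻¹F₂. So dg_x is
`splitMul J a b` (`hasFDerivAt_of_induces`), and given invertibility most of the statement is
algebra of this map.

Invertibility is the analytic core. If F₂(z) = 0, then g is constant on the sphere through x,
against injectivity; hence b ≠ 0. Given this, dg_x is injective as soon as a is not orthogonal to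
both b and Jb (`splitMul_injective`). For fixed c, the complex quadratic form of F − c is a
holomorphic function `normalForm F c` of z. Its zeros with F₂ ≠ 0 give points of the fibre of g over
c, and for c = g(x) its derivative at z vanishes exactly when a is orthogonal to b and Jb.
Injectivity of g leaves one zero in a fixed small disc for all x near x₀. If that zero were multiple
at x₀, a Hurwitz argument would make it multiple for all nearby x
(`eventually_deriv_eq_zero_of_unique_zero`). The orthogonality relations would then hold on open
patches of spheres, which forces F' = 0 (`eq_zero_of_eventually_singular`); F would be locally
constant, contradicting injectivity again (`inner_ne_zero`).

The push-forward is determined by dg_x(v) ↦ dg_x(Jv). It is orthogonal exactly when multiplication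
by J does not change inner products after applying `splitMul J a b`; an equality case of
Cauchy-Schwarz turns this into the vanishing of the associator of J, a, b (`inner_splitMul_eq_iff`).
For slice preserving g, b is real and dg_x commutes with multiplication by J. Conversely, evaluating
the push-forward at a = dg_x(1) shows that the unit of g(x) is ±J, so g maps each slice to itself
and the stem components lie in every slice, hence in ℝ. -/

/-- The real part of an octonion. -/
def re (x : Octonion) : ℝ := x.fst.re

theorem inner_def (x y : Octonion) :
    inner ℝ x y = inner ℝ x.fst y.fst + inner ℝ x.snd y.snd := rfl

theorem inner_eq (x y : Octonion) : inner ℝ x y =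
    x.fst.re * y.fst.re + x.fst.imI * y.fst.imI + x.fst.imJ * y.fst.imJ + x.fst.imK * y.fst.imK +
    (x.snd.re * y.snd.re + x.snd.imI * y.snd.imI + x.snd.imJ * y.snd.imJ +
      x.snd.imK * y.snd.imK) := by
  simp [inner_def, Quaternion.inner_def]

theorem norm_sq_eq (x : Octonion) : ‖x‖ ^ 2 =
    x.fst.re * x.fst.re + x.fst.imI * x.fst.imI + x.fst.imJ * x.fst.imJ + x.fst.imK * x.fst.imK +
    (x.snd.re * x.snd.re + x.snd.imI * x.snd.imI + x.snd.imJ * x.snd.imJ +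
      x.snd.imK * x.snd.imK) := by
  rw [← real_inner_self_eq_norm_sq, inner_eq]

@[simp] theorem fst_conj (x : Octonion) : (conj x).fst = star x.fst := rfl
@[simp] theorem snd_conj (x : Octonion) : (conj x).snd = -x.snd := rfl

theorem inner_mul_left (a x y : Octonion) : inner ℝ (a * x) y = inner ℝ x (conj a * y) := by
  simp only [inner_eq, fst_mul, snd_mul, fst_conj, snd_conj]
  simp
  ring

theorem inner_mul_right (a x y : Octonion) : inner ℝ (x * a) y = inner ℝ x (y * conj a) := by
  simp only [inner_eq, fst_mul, snd_mul, fst_conj, snd_conj]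
  simp
  ring

/-- This and `mul_mul_conj` replace associativity: multiplicativity of the norm, cancellation of
inverses and J(Jx) = −x all follow from them. -/
theorem conj_mul_mul (a x : Octonion) : conj a * (a * x) = (‖a‖ ^ 2) • x := by
  have h := norm_sq_eq a
  ext <;> simp [h] <;> ring

theorem mul_mul_conj (x a : Octonion) : (x * a) * conj a = (‖a‖ ^ 2) • x := by
  have h := norm_sq_eq a
  ext <;> simp [h] <;> ring

theorem conj_eq (x : Octonion) : conj x = (2 * re x) • (1 : Octonion) - x := by
  ext <;> simp [re]; ring

theorem re_eq_inner (x : Octonion) : re x = inner ℝ 1 x := by simp [inner_eq, re]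

theorem norm_one : ‖(1 : Octonion)‖ = 1 := by
  rw [← sq_eq_sq₀ (norm_nonneg _) zero_le_one, norm_sq_eq]
  simp

@[simp] theorem re_one : re 1 = 1 := rfl
@[simp] theorem re_add (x y : Octonion) : re (x + y) = re x + re y := rfl
@[simp] theorem re_sub (x y : Octonion) : re (x - y) = re x - re y := rfl
@[simp] theorem re_neg (x : Octonion) : re (-x) = -re x := rfl
@[simp] theorem re_smul (r : ℝ) (x : Octonion) : re (r • x) = r * re x := rfl

@[simp] theorem conj_conj (x : Octonion) : conj (conj x) = x := by
  ext <;> simp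

@[simp] theorem norm_conj (x : Octonion) : ‖conj x‖ = ‖x‖ := by
  have h := norm_sq_eq x
  have h' := norm_sq_eq (conj x)
  simp at h'
  rw [← h] at h'
  exact (sq_eq_sq₀ (norm_nonneg _) (norm_nonneg _)).1 h'

theorem im_eq (x : Octonion) : im x = x - re x • (1 : Octonion) := by
  rw [im, conj_eq]; module

theorem conj_of_re_eq_zero {x : Octonion} (h : re x = 0) : conj x = -x := by
  simp [conj_eq, h]

theorem inner_mul_mul_left (a x y : Octonion) :
    inner ℝ (a * x) (a * y) = ‖a‖ ^ 2 * inner ℝ x y := by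
  rw [inner_mul_left, conj_mul_mul, inner_smul_right]

theorem inner_mul_mul_right (a x y : Octonion) :
    inner ℝ (x * a) (y * a) = ‖a‖ ^ 2 * inner ℝ x y := by
  rw [inner_mul_right, mul_mul_conj, inner_smul_right]

theorem norm_mul_eq (x y : Octonion) : ‖x * y‖ = ‖x‖ * ‖y‖ := by
  have h := inner_mul_mul_left x y y
  rw [real_inner_self_eq_norm_sq, real_inner_self_eq_norm_sq, ← mul_pow] at h
  exact (sq_eq_sq₀ (norm_nonneg _) (by positivity)).1 h

instance : NoZeroDivisors Octonion where
  eq_zero_or_eq_zero_of_mul_eq_zero {a b} h := by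
    have := norm_mul_eq a b
    rw [h, norm_zero, eq_comm, mul_eq_zero] at this
    simpa using this

theorem inv_eq (x : Octonion) : x⁻¹ = (‖x‖ ^ 2)⁻¹ • conj x := rfl

theorem mul_mul_inv (x : Octonion) {b : Octonion} (hb : b ≠ 0) : (x * b) * b⁻¹ = x := by
  have : ‖b‖ ^ 2 ≠ 0 := by simpa using hb
  rw [inv_eq, mul_smul_comm, mul_mul_conj, inv_smul_smul₀ this]

theorem mul_inv_mul (x : Octonion) {b : Octonion} (hb : b ≠ 0) : (x * b⁻¹) * b = x := by
  have : ‖b‖ ^ 2 ≠ 0 := by simpa using hb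
  have h := mul_mul_conj x (conj b)
  rw [conj_conj, norm_conj] at h
  rw [inv_eq, mul_smul_comm, smul_mul_assoc, h, inv_smul_smul₀ this]

theorem inv_mul_mul (x : Octonion) {b : Octonion} (hb : b ≠ 0) : b⁻¹ * (b * x) = x := by
  have : ‖b‖ ^ 2 ≠ 0 := by simpa using hb
  rw [inv_eq, smul_mul_assoc, conj_mul_mul, inv_smul_smul₀ this]

/-- Right multiplication by b satisfies the quadratic equation of b. -/
theorem mul_mul_self (x b : Octonion) :
    (x * b) * b = (2 * re b) • (x * b) - (‖b‖ ^ 2) • x := by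
  rw [← mul_mul_conj x b, conj_eq, mul_sub, mul_smul_comm, mul_one]; abel

theorem mul_self_eq (b : Octonion) : b * b = (2 * re b) • b - (‖b‖ ^ 2) • (1 : Octonion) := by
  simpa using mul_mul_self 1 b

theorem re_eq_zero_and_norm_eq_one {J : Octonion} (hJ : J ∈ imaginaryUnits) :
    re J = 0 ∧ ‖J‖ = 1 := by
  have h : J * J = -1 := hJ
  have h1 : ‖J‖ = 1 := by
    have := congrArg norm h
    rw [norm_mul_eq, norm_neg, norm_one] at this
    nlinarith [norm_nonneg J]
  refine ⟨?_, h1⟩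
  rw [mul_self_eq, h1] at h
  have h2 : (2 * re J) • J = 0 := by
    have := sub_eq_iff_eq_add.1 h
    rw [this]; simp
  have h3 : J ≠ 0 := fun h => by simp [h] at h1
  simpa [h3] using h2

theorem mem_imaginaryUnits {J : Octonion} : J ∈ imaginaryUnits ↔ re J = 0 ∧ ‖J‖ = 1 := by
  refine ⟨re_eq_zero_and_norm_eq_one, fun h => ?_⟩
  change J * J = -1
  rw [mul_self_eq, h.1, h.2]; simp

theorem neg_mem_imaginaryUnits {J : Octonion} (hJ : J ∈ imaginaryUnits) :
    -J ∈ imaginaryUnits := by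
  simpa [mem_imaginaryUnits] using hJ

theorem ne_zero_of_mem_imaginaryUnits {J : Octonion} (hJ : J ∈ imaginaryUnits) : J ≠ 0 := by
  rintro rfl
  simpa using (mem_imaginaryUnits.1 hJ).2

theorem conj_of_mem_imaginaryUnits {J : Octonion} (hJ : J ∈ imaginaryUnits) : conj J = -J :=
  conj_of_re_eq_zero (mem_imaginaryUnits.1 hJ).1

theorem unit_mul_mul {J : Octonion} (hJ : J ∈ imaginaryUnits) (x : Octonion) :
    J * (J * x) = -x := by
  have := conj_mul_mul J x
  rw [conj_of_mem_imaginaryUnits hJ, (mem_imaginaryUnits.1 hJ).2] at this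
  simpa [neg_eq_iff_eq_neg] using this

theorem mul_unit_mul {J : Octonion} (hJ : J ∈ imaginaryUnits) (x : Octonion) :
    (x * J) * J = -x := by
  have := mul_mul_conj x J
  rw [conj_of_mem_imaginaryUnits hJ, (mem_imaginaryUnits.1 hJ).2] at this
  simpa [neg_eq_iff_eq_neg] using this

theorem inner_unit_mul_mul {J : Octonion} (hJ : J ∈ imaginaryUnits) (x y : Octonion) :
    inner ℝ (J * x) (J * y) = inner ℝ x y := by
  simp [inner_mul_mul_left, (mem_imaginaryUnits.1 hJ).2]

theorem inner_unit_mul {J : Octonion} (hJ : J ∈ imaginaryUnits) (x y : Octonion) :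
    inner ℝ (J * x) y = -inner ℝ x (J * y) := by
  rw [inner_mul_left, conj_of_mem_imaginaryUnits hJ, neg_mul, inner_neg_right]

/-- By linearity only u = 1 and u = J matter, and the latter is J(Ja) = −a = (JJ)a. -/
theorem unit_mul_slice_mul {J : Octonion} (hJ : J ∈ imaginaryUnits)
    {u : Octonion} (hu : u ∈ slice J) (a : Octonion) :
    J * (u * a) = (J * u) * a := by
  obtain ⟨r, s, rfl⟩ := Submodule.mem_span_pair.1 hu
  have : J * J = -1 := hJ
  simp only [add_mul, mul_add, smul_mul_assoc, mul_smul_comm, one_mul, mul_one, unit_mul_mul hJ,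
    this, neg_mul]

theorem unit_mul_mem_slice {J : Octonion} (hJ : J ∈ imaginaryUnits)
    {u : Octonion} (hu : u ∈ slice J) : J * u ∈ slice J := by
  obtain ⟨r, s, rfl⟩ := Submodule.mem_span_pair.1 hu
  have : J * J = -1 := hJ
  refine Submodule.mem_span_pair.2 ⟨-s, r, ?_⟩
  simp only [mul_add, mul_smul_comm, mul_one, this]
  module

theorem mem_slice_orthogonal {J : Octonion} {v : Octonion} :
    v ∈ (slice J)ᗮ ↔ re v = 0 ∧ inner ℝ J v = 0 := by
  rw [Submodule.mem_orthogonal]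
  constructor
  · intro h
    exact ⟨by rw [re_eq_inner]; exact h _ (Submodule.subset_span (by simp)),
      h _ (Submodule.subset_span (by simp))⟩
  · rintro ⟨h1, h2⟩ u hu
    obtain ⟨r, s, rfl⟩ := Submodule.mem_span_pair.1 hu
    rw [re_eq_inner] at h1
    simp [inner_add_left, inner_smul_left, h1, h2]

theorem unit_mul_mem_slice_orthogonal {J : Octonion} (hJ : J ∈ imaginaryUnits)
    {v : Octonion} (hv : v ∈ (slice J)ᗮ) :
    J * v ∈ (slice J)ᗮ := by
  rw [mem_slice_orthogonal] at hv ⊢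
  have h := inner_unit_mul hJ 1 v
  rw [mul_one, hv.2] at h
  refine ⟨by rw [re_eq_inner]; linarith, ?_⟩
  have h2 := inner_unit_mul_mul hJ 1 v
  rw [mul_one] at h2
  rw [h2, ← re_eq_inner, hv.1]

/-! ### Slice coordinates: a non-real point as a pair (imaginary unit, point of the upper half
plane). -/

@[simp] theorem re_embed {J : Octonion} (hJ : J ∈ imaginaryUnits) (z : ℂ) :
    re (embed J z) = z.re := by
  simp [embed, (mem_imaginaryUnits.1 hJ).1]

@[simp] theorem im_embed {J : Octonion} (hJ : J ∈ imaginaryUnits) (z : ℂ) :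
    im (embed J z) = z.im • J := by
  rw [im_eq, re_embed hJ, embed]; abel

theorem norm_im_embed {J : Octonion} (hJ : J ∈ imaginaryUnits) {z : ℂ} (hz : 0 ≤ z.im) :
    ‖im (embed J z)‖ = z.im := by
  rw [im_embed hJ, norm_smul, (mem_imaginaryUnits.1 hJ).2, Real.norm_of_nonneg hz, mul_one]

theorem embed_neg (J : Octonion) (z : ℂ) : embed (-J) z = embed J ((starRingEnd ℂ) z) := by
  simp [embed]

theorem conj_embed {J : Octonion} (hJ : J ∈ imaginaryUnits) (z : ℂ) :
    conj (embed J z) = embed J ((starRingEnd ℂ) z) := by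
  rw [conj_eq, re_embed hJ, embed, embed]
  simp only [Complex.conj_re, Complex.conj_im]
  module

theorem mem_realAxis {x : Octonion} : x ∈ realAxis ↔ im x = 0 := by
  rw [realAxis, Submodule.mem_span_singleton, im_eq, sub_eq_zero]
  exact ⟨fun ⟨a, ha⟩ => by simp [← ha], fun h => ⟨_, h.symm⟩⟩

@[simp] theorem re_im (x : Octonion) : re (im x) = 0 := by simp [im_eq]

/-- The imaginary unit of the slice through `x`. -/
noncomputable def unit (x : Octonion) : Octonion := ‖im x‖⁻¹ • im x

/-- The point of the closed upper half plane that corresponds to `x`. -/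
noncomputable def toUpper (x : Octonion) : ℂ := ⟨re x, ‖im x‖⟩

theorem unit_mem {x : Octonion} (hx : im x ≠ 0) : unit x ∈ imaginaryUnits := by
  rw [mem_imaginaryUnits]
  refine ⟨by simp [unit], ?_⟩
  rw [unit, norm_smul, norm_inv, norm_norm, inv_mul_cancel₀ (by simpa using hx)]

theorem embed_unit_toUpper {x : Octonion} (hx : im x ≠ 0) : embed (unit x) (toUpper x) = x := by
  simp only [embed, unit, toUpper]
  rw [smul_inv_smul₀ (by simpa using hx), im_eq]; abel

theorem unit_embed {J : Octonion} (hJ : J ∈ imaginaryUnits) {z : ℂ} (hz : 0 < z.im) :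
    unit (embed J z) = J := by
  rw [unit, norm_im_embed hJ hz.le, im_embed hJ, inv_smul_smul₀ hz.ne']

theorem toUpper_embed {J : Octonion} (hJ : J ∈ imaginaryUnits) {z : ℂ} (hz : 0 < z.im) :
    toUpper (embed J z) = z := by
  rw [toUpper, norm_im_embed hJ hz.le, re_embed hJ]

theorem toUpper_mem {D : Set ℂ} (hD : IsAdmissible D) {x : Octonion}
    (hx : x ∈ circularization D) (hx' : im x ≠ 0) : toUpper x ∈ D := by
  obtain ⟨J, hJ, z, hz, rfl⟩ := hx
  rcases lt_trichotomy z.im 0 with h | h | h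
  · have h1 := toUpper_embed (neg_mem_imaginaryUnits hJ) (z := (starRingEnd ℂ) z) (by simpa using h)
    rw [embed_neg, Complex.conj_conj] at h1
    rw [h1]; exact hD.conj_mem z hz
  · simp [im_embed hJ, h] at hx'
  · rwa [toUpper_embed hJ h]

/-! ### Associators -/

/-- The square of right multiplication by b is a real combination of itself and the identity, so J
passes through the second factor b once it passes through the first. -/
theorem mul_assoc_mul_of_mul_assoc {J w b : Octonion} (h : associator J w b = 0) :
    associator J (w * b) b = 0 := by
  rw [associator_apply, sub_eq_zero] at h ⊢
  rw [← h, mul_mul_self, mul_mul_self, mul_sub, mul_smul_comm, mul_smul_comm, h]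

theorem associator_conj (x y z : Octonion) :
    associator x y (conj z) = -associator x y z := by
  simp only [associator_apply, conj_eq, mul_sub, mul_smul_comm, mul_one]; abel

theorem associator_smul_left (r : ℝ) (x y z : Octonion) :
    associator (r • x) y z = r • associator x y z := by
  simp only [associator_apply, smul_mul_assoc, smul_sub]

theorem associator_smul_mid (r : ℝ) (x y z : Octonion) :
    associator x (r • y) z = r • associator x y z := by
  simp only [associator_apply, smul_mul_assoc, mul_smul_comm, smul_sub]

theorem associator_smul_right (r : ℝ) (x y z : Octonion) :
    associator x y (r • z) = r • associator x y z := by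
  simp only [associator_apply, mul_smul_comm, smul_sub]

/-- b⁻¹ is a real multiple of the conjugate of b, which differs from −b by a real number, and real
numbers contribute nothing to associators. -/
theorem associator_mul_inv_eq_zero_iff {J a b : Octonion} (hb : b ≠ 0) :
    associator J (a * b⁻¹) b = 0 ↔ associator J a b = 0 := by
  constructor
  · intro h
    simpa [mul_inv_mul a hb] using mul_assoc_mul_of_mul_assoc h
  · intro h
    have h1 : associator J a (conj b) = 0 := by rw [associator_conj, h, neg_zero]
    have h2 := mul_assoc_mul_of_mul_assoc h1
    rw [associator_conj, neg_eq_zero] at h2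
    rw [inv_eq, mul_smul_comm, associator_smul_mid, h2, smul_zero]

/-- An instance of Artin's theorem: all arguments lie in the subalgebra generated by the two
elements I and J. -/
theorem associator_slice {I J p q r : Octonion} (hI : I ∈ imaginaryUnits)
    (hJ : J ∈ imaginaryUnits) (hp : p ∈ slice J) (hq : q ∈ slice J) (hr : r ∈ slice J) :
    associator I (p + I * q) r = 0 := by
  obtain ⟨p0, p1, rfl⟩ := Submodule.mem_span_pair.1 hp
  obtain ⟨q0, q1, rfl⟩ := Submodule.mem_span_pair.1 hq
  obtain ⟨r0, r1, rfl⟩ := Submodule.mem_span_pair.1 hr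
  have hII : I * I = -1 := hI
  have hJJ : J * J = -1 := hJ
  simp only [associator_apply, add_mul, mul_add, smul_mul_assoc, mul_smul_comm, one_mul, mul_one,
    unit_mul_mul hI, mul_unit_mul hJ, hII, hJJ, neg_mul, mul_neg, smul_neg]
  module

end Octonion

namespace Octonion
noncomputable section

/-! ### Differential calculus on the octonions -/

/-- The octonion product as a continuous bilinear map. -/
def mulL : Octonion →L[ℝ] Octonion →L[ℝ] Octonion :=
  LinearMap.mkContinuous₂ (LinearMap.mul ℝ Octonion) 1 fun x y => by
    simp [norm_mul_eq]

@[simp] theorem mulL_apply (x y : Octonion) : mulL x y = x * y := rfl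

/-- The imaginary part as a continuous linear map. -/
def imL : Octonion →L[ℝ] Octonion :=
  ContinuousLinearMap.id ℝ Octonion - (innerSL ℝ (1 : Octonion)).smulRight (1 : Octonion)

@[simp] theorem imL_apply (x : Octonion) : imL x = im x := by
  simp [imL, im_eq, re_eq_inner]

/-- The orthogonal projection onto the slice of the imaginary unit `J`. -/
def sliceProj (J : Octonion) : Octonion →L[ℝ] Octonion :=
  (innerSL ℝ (1 : Octonion)).smulRight (1 : Octonion) + (innerSL ℝ J).smulRight J

theorem sliceProj_apply (J v : Octonion) :
    sliceProj J v = re v • (1 : Octonion) + (inner ℝ J v : ℝ) • J := by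
  simp [sliceProj, re_eq_inner]

theorem sliceProj_mem (J v : Octonion) : sliceProj J v ∈ slice J :=
  Submodule.mem_span_pair.2 ⟨_, _, (sliceProj_apply J v).symm⟩

theorem sub_sliceProj_mem {J : Octonion} (hJ : J ∈ imaginaryUnits) (v : Octonion) :
    v - sliceProj J v ∈ (slice J)ᗮ := by
  have h1 : inner ℝ J (1 : Octonion) = 0 := by
    rw [real_inner_comm, ← re_eq_inner, (mem_imaginaryUnits.1 hJ).1]
  rw [mem_slice_orthogonal, sliceProj_apply]
  simp [(mem_imaginaryUnits.1 hJ).1, (mem_imaginaryUnits.1 hJ).2, inner_sub_right,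
    inner_add_right, inner_smul_right, h1]

theorem sliceProj_of_mem {J : Octonion} (hJ : J ∈ imaginaryUnits) {u : Octonion}
    (hu : u ∈ slice J) : sliceProj J u = u := by
  have h := sub_sliceProj_mem hJ u
  have h2 := (slice J).sub_mem hu (sliceProj_mem J u)
  exact (sub_eq_zero.1 ((Submodule.mem_bot ℝ).1
    ((slice J).inf_orthogonal_eq_bot ▸ Submodule.mem_inf.2 ⟨h2, h⟩))).symm

theorem sliceProj_of_mem_orthogonal {J v : Octonion} (hv : v ∈ (slice J)ᗮ) :
    sliceProj J v = 0 := by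
  rw [mem_slice_orthogonal] at hv
  simp [sliceProj_apply, hv.1, hv.2]

/-- The linear map that is right multiplication by `a` on the slice of `J`, and right
multiplication by `b` on its orthogonal complement. -/
def splitMul (J a b : Octonion) : Octonion →L[ℝ] Octonion :=
  (mulL.flip a).comp (sliceProj J) +
    (mulL.flip b).comp (ContinuousLinearMap.id ℝ Octonion - sliceProj J)

theorem splitMul_apply (J a b v : Octonion) :
    splitMul J a b v = sliceProj J v * a + (v - sliceProj J v) * b := rfl

theorem splitMul_of_mem {J : Octonion} (hJ : J ∈ imaginaryUnits) (a b : Octonion) {u : Octonion}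
    (hu : u ∈ slice J) : splitMul J a b u = u * a := by
  simp [splitMul_apply, sliceProj_of_mem hJ hu]

theorem splitMul_of_mem_orthogonal {J : Octonion} (a b : Octonion) {v : Octonion}
    (hv : v ∈ (slice J)ᗮ) : splitMul J a b v = v * b := by
  simp [splitMul_apply, sliceProj_of_mem_orthogonal hv]

/-- Let w = p + v be in the kernel, p in the slice and v orthogonal to it. Then vb, hence also pa,
is orthogonal to b and Jb. With p = r + sJ this is a homogeneous linear system for r, s with
determinant ±(A² + B²), where A = ⟨a, b⟩ and B = ⟨Ja, b⟩. So p = 0, then vb = 0 and v = 0. -/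
theorem splitMul_injective {J a b : Octonion} (hJ : J ∈ imaginaryUnits) (hb : b ≠ 0)
    (h : inner ℝ a b ≠ (0 : ℝ) ∨ inner ℝ (J * a) b ≠ (0 : ℝ)) :
    Function.Injective (splitMul J a b) := by
  rw [injective_iff_map_eq_zero]
  intro w hw
  rw [splitMul_apply] at hw
  obtain ⟨h1, h2⟩ := mem_slice_orthogonal.1 (sub_sliceProj_mem hJ w)
  set v := w - sliceProj J w with hv
  have e1 : inner ℝ (sliceProj J w * a) b = (0 : ℝ) := by
    have := inner_mul_mul_right b v 1
    rw [one_mul] at this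
    rw [eq_neg_of_add_eq_zero_left hw, inner_neg_left, this, real_inner_comm, ← re_eq_inner, h1,
      mul_zero, neg_zero]
  have e2 : inner ℝ (sliceProj J w * a) (J * b) = (0 : ℝ) := by
    rw [eq_neg_of_add_eq_zero_left hw, inner_neg_left, inner_mul_mul_right, real_inner_comm, h2,
      mul_zero, neg_zero]
  rw [sliceProj_apply] at e1 e2
  simp only [add_mul, smul_mul_assoc, one_mul, inner_add_left, inner_smul_left,
    inner_unit_mul_mul hJ] at e1 e2
  have e3 : inner ℝ a (J * b) = -(inner ℝ (J * a) b : ℝ) := by rw [inner_unit_mul hJ, neg_neg]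
  rw [e3] at e2
  simp only [conj_trivial] at e1 e2
  set r := re w
  set s : ℝ := inner ℝ J w
  set A : ℝ := inner ℝ a b
  set B : ℝ := inner ℝ (J * a) b
  have hAB : A ^ 2 + B ^ 2 ≠ 0 := by
    rcases h with h | h <;> positivity
  have hr : r = 0 := by
    have : r * (A ^ 2 + B ^ 2) = 0 := by linear_combination A * e1 - B * e2
    simpa [hAB] using this
  have hs : s = 0 := by
    have : s * (A ^ 2 + B ^ 2) = 0 := by linear_combination B * e1 + A * e2
    simpa [hAB] using this
  have hp : sliceProj J w = 0 := by
    rw [sliceProj_apply]; change r • _ + s • _ = _; rw [hr, hs]; simp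
  rw [hp, zero_mul, zero_add] at hw
  rcases mul_eq_zero.1 hw with hw | hw
  · rw [hv, hp, sub_zero] at hw; exact hw
  · exact absurd hw hb

/-! ### Smoothness and differentials of the slice coordinates. -/

theorem contDiff_im : ContDiff ℝ ∞ im := by
  have : im = imL := by ext1 x; simp
  rw [this]; exact imL.contDiff

theorem contDiff_re : ContDiff ℝ ∞ re := by
  have : re = innerSL ℝ (1 : Octonion) := by ext1 x; simp [re_eq_inner]
  rw [this]; exact (innerSL ℝ (1 : Octonion)).contDiff

theorem contDiffAt_norm_im {x : Octonion} (hx : im x ≠ 0) :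
    ContDiffAt ℝ ∞ (fun x => ‖im x‖) x :=
  contDiff_im.contDiffAt.norm ℝ hx

theorem contDiffAt_unit {x : Octonion} (hx : im x ≠ 0) : ContDiffAt ℝ ∞ unit x :=
  ((contDiffAt_norm_im hx).inv (by simpa using hx)).smul contDiff_im.contDiffAt

theorem toUpper_eq (x : Octonion) : toUpper x = (re x : ℂ) + ‖im x‖ * Complex.I := by
  simp [toUpper, Complex.ext_iff]

theorem contDiffAt_toUpper {x : Octonion} (hx : im x ≠ 0) : ContDiffAt ℝ ∞ toUpper x := by
  have : toUpper = fun x => re x • (1 : ℂ) + ‖im x‖ • Complex.I := by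
    ext1 x; simp [toUpper_eq]
  rw [this]
  exact (contDiff_re.contDiffAt.smul contDiffAt_const).add
    ((contDiffAt_norm_im hx).smul contDiffAt_const)

theorem stdJ_apply (x v : Octonion) : stdJ x v = unit x * v := rfl

theorem contDiffAt_stdJ {x : Octonion} (hx : im x ≠ 0) : ContDiffAt ℝ ∞ stdJ x :=
  mulL.contDiff.contDiffAt.comp x (contDiffAt_unit hx)

theorem inner_im_im (x v : Octonion) : inner ℝ (im x) (im v) = (inner ℝ (im x) v : ℝ) := by
  have : inner ℝ (im x) (1 : Octonion) = (0 : ℝ) := by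
    rw [real_inner_comm, ← re_eq_inner, re_im]
  rw [im_eq v, inner_sub_right, inner_smul_right, this, mul_zero, sub_zero]

theorem hasFDerivAt_im (x : Octonion) : HasFDerivAt im imL x := by
  have : im = imL := by ext1 x; simp
  rw [this]; exact imL.hasFDerivAt

theorem hasFDerivAt_re (x : Octonion) : HasFDerivAt re (innerSL ℝ (1 : Octonion)) x := by
  have : re = innerSL ℝ (1 : Octonion) := by ext1 x; simp [re_eq_inner]
  rw [this]; exact (innerSL ℝ (1 : Octonion)).hasFDerivAt

theorem hasFDerivAt_norm_im {x : Octonion} (hx : im x ≠ 0) :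
    HasFDerivAt (fun x => ‖im x‖) (innerSL ℝ (unit x)) x := by
  have hx' : ‖im x‖ ≠ 0 := by simpa using hx
  have h := ((hasFDerivAt_im x).norm_sq).sqrt (by positivity)
  simp only [Real.sqrt_sq (norm_nonneg _)] at h
  refine h.congr_fderiv ?_
  ext1 v
  simp [unit, inner_im_im]
  field_simp

/-- The differential of `toUpper`. -/
def toUpperDeriv (J : Octonion) : Octonion →L[ℝ] ℂ :=
  (innerSL ℝ (1 : Octonion)).smulRight (1 : ℂ) + (innerSL ℝ J).smulRight Complex.I

theorem hasFDerivAt_toUpper {x : Octonion} (hx : im x ≠ 0) :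
    HasFDerivAt toUpper (toUpperDeriv (unit x)) x := by
  have : toUpper = fun x => re x • (1 : ℂ) + ‖im x‖ • Complex.I := by
    ext1 x; simp [toUpper_eq]
  rw [this]
  exact ((hasFDerivAt_re x).smul_const (1 : ℂ)).add
    ((hasFDerivAt_norm_im hx).smul_const Complex.I)

/-- The imaginary unit does not change along the slice of x; in orthogonal directions it moves along
a sphere of radius ‖im x‖ rescaled to radius 1. -/
theorem hasFDerivAt_unit {x : Octonion} (hx : im x ≠ 0) :
    HasFDerivAt unit
      (‖im x‖⁻¹ • (ContinuousLinearMap.id ℝ Octonion - sliceProj (unit x))) x := by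
  have hx' : ‖im x‖ ≠ 0 := by simpa using hx
  have h := (((hasDerivAt_inv hx').comp_hasFDerivAt x (hasFDerivAt_norm_im hx))).smul
    (hasFDerivAt_im x)
  refine h.congr_fderiv ?_
  ext1 v
  simp [sliceProj_apply, im_eq v, unit, inner_smul_left, sub_eq_add_neg, smul_smul,
    add_assoc]
  module

end
end Octonion

namespace Octonion
noncomputable section

/-! ### Holomorphic stem functions -/

theorem hasDerivAt_of_cauchyRiemann {p q : ℂ → ℝ} {p' q' : ℂ →L[ℝ] ℝ} {z : ℂ}
    (hp : HasFDerivAt p p' z) (hq : HasFDerivAt q q' z)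
    (h1 : p' Complex.I = -q' 1) (h2 : q' Complex.I = p' 1) :
    HasDerivAt (fun w => (⟨p w, q w⟩ : ℂ)) ⟨p' 1, q' 1⟩ z := by
  have e : (fun w => (⟨p w, q w⟩ : ℂ)) = fun w => p w • (1 : ℂ) + q w • Complex.I := by
    ext1 w; simp [Complex.ext_iff]
  have h : HasFDerivAt (fun w => (⟨p w, q w⟩ : ℂ))
      (p'.smulRight (1 : ℂ) + q'.smulRight Complex.I) z := by
    rw [e]; exact (hp.smul_const (1 : ℂ)).add (hq.smul_const Complex.I)
  refine hasFDerivAt_of_restrictScalars ℝ h ?_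
  ext1 w
  have hw : w = w.re • (1 : ℂ) + w.im • Complex.I := by simp
  have hp' : p' w = w.re * p' 1 + w.im * p' Complex.I := by
    conv_lhs => rw [hw]
    simp only [map_add, map_smul, smul_eq_mul]
  have hq' : q' w = w.re * q' 1 + w.im * q' Complex.I := by
    conv_lhs => rw [hw]
    simp only [map_add, map_smul, smul_eq_mul]
  simp [Complex.ext_iff, hp', hq', h1, h2]
  ring

/-- The derivative of a stem function along the real axis. -/
def stemDeriv (F : ℂ → Octonion × Octonion) (z : ℂ) : Octonion × Octonion := fderiv ℝ F z 1

namespace IsHolomorphicStem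

variable {D : Set ℂ} {F : ℂ → Octonion × Octonion}

theorem differentiableAt (hF : IsHolomorphicStem D F) (hD : IsOpen D) {z : ℂ} (hz : z ∈ D) :
    DifferentiableAt ℝ F z :=
  (hF.contDiffOn.contDiffAt (hD.mem_nhds hz)).differentiableAt one_ne_zero

theorem fderiv_I (hF : IsHolomorphicStem D F) {z : ℂ} (hz : z ∈ D) :
    fderiv ℝ F z Complex.I = mulI (stemDeriv F z) := by
  have h := hF.dbar_eq_zero z hz
  rw [dbar, smul_eq_zero, or_iff_right (by norm_num), Prod.ext_iff] at h
  simp only [mulI, Prod.fst_add, Prod.snd_add, Prod.fst_zero, Prod.snd_zero] at h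
  exact Prod.ext (eq_neg_of_add_eq_zero_right h.2) (add_neg_eq_zero.1 h.1).symm

theorem dz_eq (hF : IsHolomorphicStem D F) {z : ℂ} (hz : z ∈ D) : dz F z = stemDeriv F z := by
  rw [dz, hF.fderiv_I hz]
  have : mulI (mulI (stemDeriv F z)) = -stemDeriv F z := rfl
  rw [this, stemDeriv, sub_neg_eq_add, ← two_smul ℝ, smul_smul]; norm_num

theorem fderiv_apply (hF : IsHolomorphicStem D F) {z : ℂ} (hz : z ∈ D) (w : ℂ) :
    fderiv ℝ F z w = w.re • stemDeriv F z + w.im • mulI (stemDeriv F z) := by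
  have hw : w = w.re • (1 : ℂ) + w.im • Complex.I := by simp
  conv_lhs => rw [hw]
  rw [map_add, map_smul, map_smul, hF.fderiv_I hz, stemDeriv]

theorem hasFDerivAt_fst (hF : IsHolomorphicStem D F) (hD : IsOpen D) {z : ℂ} (hz : z ∈ D) :
    HasFDerivAt (fun w => (F w).1)
      ((ContinuousLinearMap.fst ℝ Octonion Octonion).comp (fderiv ℝ F z)) z :=
  (hF.differentiableAt hD hz).hasFDerivAt.fst

theorem hasFDerivAt_snd (hF : IsHolomorphicStem D F) (hD : IsOpen D) {z : ℂ} (hz : z ∈ D) :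
    HasFDerivAt (fun w => (F w).2)
      ((ContinuousLinearMap.snd ℝ Octonion Octonion).comp (fderiv ℝ F z)) z :=
  (hF.differentiableAt hD hz).hasFDerivAt.snd

/-- Pairing with a fixed vector turns a holomorphic stem function into an ordinary holomorphic
function; smoothness and invariance of subspaces are deduced from these coordinates. -/
theorem hasDerivAt_inner (hF : IsHolomorphicStem D F) (hD : IsOpen D) {z : ℂ} (hz : z ∈ D)
    (v : Octonion) :
    HasDerivAt (fun w => (⟨inner ℝ v (F w).1, inner ℝ v (F w).2⟩ : ℂ))
      ⟨inner ℝ v (stemDeriv F z).1, inner ℝ v (stemDeriv F z).2⟩ z := by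
  refine hasDerivAt_of_cauchyRiemann
    ((innerSL ℝ v).hasFDerivAt.comp z (hF.hasFDerivAt_fst hD hz))
    ((innerSL ℝ v).hasFDerivAt.comp z (hF.hasFDerivAt_snd hD hz)) ?_ ?_ <;>
  simp [hF.fderiv_I hz, mulI, stemDeriv]

theorem contDiffOn_top (hF : IsHolomorphicStem D F) (hD : IsOpen D) : ContDiffOn ℝ ∞ F D := by
  intro z hz
  refine ContDiffAt.contDiffWithinAt ?_
  have key (v : Octonion) :
      ContDiffAt ℝ ∞ (fun w => (⟨inner ℝ v (F w).1, inner ℝ v (F w).2⟩ : ℂ)) z := by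
    have h : DifferentiableOn ℂ (fun w => (⟨inner ℝ v (F w).1, inner ℝ v (F w).2⟩ : ℂ)) D :=
      fun w hw => (hF.hasDerivAt_inner hD hw v).differentiableAt.differentiableWithinAt
    exact ((h.contDiffOn hD).contDiffAt (hD.mem_nhds hz)).restrict_scalars ℝ
  let e := stdOrthonormalBasis ℝ Octonion
  refine ContDiffAt.prodMk (f := fun z => (F z).1) (g := fun z => (F z).2) ?_ ?_
  · have : (fun z => (F z).1) = fun z => ∑ i, (inner ℝ (e i) (F z).1 : ℝ) • e i := by
      ext1 z; exact (e.sum_repr' _).symm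
    rw [this]
    exact ContDiffAt.sum fun i _ =>
      (Complex.reCLM.contDiff.contDiffAt.comp z (key (e i))).smul contDiffAt_const
  · have : (fun z => (F z).2) = fun z => ∑ i, (inner ℝ (e i) (F z).2 : ℝ) • e i := by
      ext1 z; exact (e.sum_repr' _).symm
    rw [this]
    exact ContDiffAt.sum fun i _ =>
      (Complex.imCLM.contDiff.contDiffAt.comp z (key (e i))).smul contDiffAt_const

end IsHolomorphicStem

/-! ### The normal form and the fibres of a slice function. -/

/-- The complex quadratic form of `F z - c`: its zeros describe the fibre over `c` of the
slice function induced by `F`. -/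
def normalForm (F : ℂ → Octonion × Octonion) (c : Octonion) (z : ℂ) : ℂ :=
  ⟨‖(F z).1 - c‖ ^ 2 - ‖(F z).2‖ ^ 2, 2 * inner ℝ ((F z).1 - c) (F z).2⟩

/-- With B the complex bilinear extension of the inner product, the normal form is B(F − c, F − c),
so its derivative is 2B(F − c, F'). -/
theorem IsHolomorphicStem.hasDerivAt_normalForm {D : Set ℂ} {F : ℂ → Octonion × Octonion}
    (hF : IsHolomorphicStem D F) (hD : IsOpen D) {z : ℂ} (hz : z ∈ D) (c : Octonion) :
    HasDerivAt (normalForm F c)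
      ⟨2 * (inner ℝ ((F z).1 - c) (stemDeriv F z).1 - inner ℝ (F z).2 (stemDeriv F z).2),
        2 * (inner ℝ ((F z).1 - c) (stemDeriv F z).2 + inner ℝ (F z).2 (stemDeriv F z).1)⟩ z := by
  have h1 := (hF.hasFDerivAt_fst hD hz).sub_const c
  have h2 := hF.hasFDerivAt_snd hD hz
  refine (hasDerivAt_of_cauchyRiemann (h1.norm_sq.sub h2.norm_sq)
    ((h1.inner ℝ h2).const_mul 2) ?_ ?_).congr_deriv ?_
  · simp [hF.fderiv_I hz, mulI, stemDeriv, real_inner_comm, inner_sub_left]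
    ring
  · simp [hF.fderiv_I hz, mulI, stemDeriv, real_inner_comm, inner_sub_left]
    ring
  · simp [stemDeriv, real_inner_comm, inner_sub_left, mul_sub]

theorem normalForm_embedC {F : ℂ → Octonion × Octonion} {J : Octonion} (hJ : J ∈ imaginaryUnits)
    (z : ℂ) : normalForm F (embedC J (F z)) z = 0 := by
  have h : inner ℝ (J * (F z).2) (F z).2 = (0 : ℝ) := by
    have := inner_unit_mul hJ (F z).2 (F z).2
    rw [real_inner_comm (J * (F z).2)] at this
    linarith
  have e : (F z).1 - embedC J (F z) = -(J * (F z).2) := by rw [embedC]; abel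
  rw [normalForm, e, norm_neg, inner_neg_left, h, norm_mul_eq, (mem_imaginaryUnits.1 hJ).2]
  simp [Complex.ext_iff]

/-- The unit solves F₁ + J F₂ = c. Vanishing of the imaginary part of the normal form gives re J =
0, and vanishing of the real part gives ‖J‖ = 1. -/
theorem mem_imaginaryUnits_of_normalForm_eq_zero {F : ℂ → Octonion × Octonion} {c : Octonion}
    {z : ℂ} (h2 : (F z).2 ≠ 0) (h : normalForm F c z = 0) :
    (c - (F z).1) * (F z).2⁻¹ ∈ imaginaryUnits := by
  set J := (c - (F z).1) * (F z).2⁻¹ with hJ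
  have hn : ‖(F z).2‖ ≠ 0 := by simpa using h2
  have e : J * (F z).2 = c - (F z).1 := mul_inv_mul _ h2
  have e' : (F z).1 - c = -(J * (F z).2) := by rw [e, neg_sub]
  rw [normalForm, e', Complex.ext_iff, norm_neg, inner_neg_left] at h
  obtain ⟨ha, hb⟩ := h
  simp only [Complex.zero_re, Complex.zero_im] at ha hb
  have h1 := inner_mul_mul_right (F z).2 J 1
  rw [one_mul] at h1
  rw [h1, real_inner_comm, ← re_eq_inner] at hb
  rw [norm_mul_eq] at ha
  refine mem_imaginaryUnits.2 ⟨by simpa [hn] using hb, ?_⟩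
  rw [← sq_eq_sq₀ (norm_nonneg _) zero_le_one]
  have : (‖J‖ ^ 2 - 1) * ‖(F z).2‖ ^ 2 = 0 := by linear_combination ha
  have := (mul_eq_zero.1 this).resolve_right (pow_ne_zero 2 hn)
  linarith

/-! ### Slice regular functions -/

/-- Product rule for F₁ + J F₂ in slice coordinates: differentiating z gives the slice part through
Cauchy-Riemann, and differentiating J gives the orthogonal part. -/
theorem hasFDerivAt_of_induces {D : Set ℂ} (hD : IsAdmissible D)
    {F : ℂ → Octonion × Octonion} {g : Octonion → Octonion} (hF : IsHolomorphicStem D F)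
    (hFg : Induces D F g) {U : Set Octonion} (hU : IsOpen U)
    (hUD : U ⊆ circularization D \ (realAxis : Set Octonion)) {x : Octonion} (hx : x ∈ U) :
    ContDiffAt ℝ ∞ g x ∧
    HasFDerivAt g (splitMul (unit x) (embedC (unit x) (stemDeriv F (toUpper x)))
      (‖im x‖⁻¹ • (F (toUpper x)).2)) x := by
  have him {y : Octonion} (hy : y ∈ U) : im y ≠ 0 := fun h => (hUD hy).2 (mem_realAxis.2 h)
  have hmem {y : Octonion} (hy : y ∈ U) : toUpper y ∈ D := toUpper_mem hD (hUD hy).1 (him hy)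
  have heq : g =ᶠ[𝓝 x] fun y => (F (toUpper y)).1 + mulL (unit y) (F (toUpper y)).2 := by
    filter_upwards [hU.mem_nhds hx] with y hy
    have := hFg _ (unit_mem (him hy)) _ (hmem hy)
    rwa [embed_unit_toUpper (him hy)] at this
  have hFc : ContDiffAt ℝ ∞ (fun y => F (toUpper y)) x :=
    ((hF.contDiffOn_top hD.isOpen).contDiffAt (hD.isOpen.mem_nhds (hmem hx))).comp x
      (contDiffAt_toUpper (him hx))
  constructor
  · refine ContDiffAt.congr_of_eventuallyEq ?_ heq
    exact hFc.fst.add ((mulL.contDiff.contDiffAt.comp x (contDiffAt_unit (him hx))).clm_apply hFc.snd)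
  · refine HasFDerivAt.congr_of_eventuallyEq ?_ heq
    have h1 := (hF.hasFDerivAt_fst hD.isOpen (hmem hx)).comp x (hasFDerivAt_toUpper (him hx))
    have h2 := (hF.hasFDerivAt_snd hD.isOpen (hmem hx)).comp x (hasFDerivAt_toUpper (him hx))
    refine (h1.add (mulL.hasFDerivAt_of_bilinear (hasFDerivAt_unit (him hx)) h2)).congr_fderiv ?_
    ext1 v
    have := unit_mul_mul (unit_mem (him hx))
    simp [hF.fderiv_apply (hmem hx), toUpperDeriv, mulI, splitMul_apply, sliceProj_apply, embedC,
      ← re_eq_inner, mul_add, add_mul, sub_mul, this, mul_smul_comm, smul_mul_assoc]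
    module

end
end Octonion

/-! ### Persistence of multiple zeros. -/

/-- A version of Hurwitz' theorem: if the holomorphic functions `N x` have exactly one zero `ζ x`
in a closed disc around `ζ x₀`, and `ζ x₀` is a multiple zero of `N x₀`, then `ζ x` is a multiple
zero of `N x` for `x` close to `x₀`. -/
theorem eventually_deriv_eq_zero_of_unique_zero {X : Type*} [TopologicalSpace X] {N : X → ℂ → ℂ}
    {ζ : X → ℂ} {x₀ : X} {r : ℝ} (hr : 0 < r) {D : Set ℂ}
    (hrD : Metric.closedBall (ζ x₀) r ⊆ D)
    (hζ : ContinuousAt ζ x₀) (hd : ∀ᶠ x in 𝓝 x₀, DifferentiableOn ℂ (N x) D)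
    (hz : ∀ᶠ x in 𝓝 x₀, N x (ζ x) = 0)
    (hne : ∀ᶠ x in 𝓝 x₀, ∀ z ∈ Metric.closedBall (ζ x₀) r, N x z = 0 → z = ζ x)
    (hc : ∀ z ∈ Metric.sphere (ζ x₀) r, ContinuousAt (fun p : X × ℂ => N p.1 p.2) (x₀, z))
    (h0 : deriv (N x₀) (ζ x₀) = 0) :
    ∀ᶠ x in 𝓝 x₀, deriv (N x) (ζ x) = 0 := by
  -- On the circle, q is the holomorphic quotient `dslope (N x) (ζ x)`. It is bounded below by m at
  -- x₀, and near x₀ it differs from its value there by less than m / 3.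
  let q : X × ℂ → ℂ := fun p => N p.1 p.2 / (p.2 - ζ p.1)
  have hsph {z : ℂ} (hz : z ∈ Metric.sphere (ζ x₀) r) : z - ζ x₀ ≠ 0 := by
    rw [mem_sphere_iff_norm] at hz
    rw [← norm_ne_zero_iff, hz]; exact hr.ne'
  have hq (z : ℂ) (hz : z ∈ Metric.sphere (ζ x₀) r) : ContinuousAt q (x₀, z) :=
    (hc z hz).div (continuousAt_snd.sub (ContinuousAt.comp (f := Prod.fst) hζ continuousAt_fst))
      (hsph hz)
  have hq0 : ContinuousOn (fun z => q (x₀, z)) (Metric.sphere (ζ x₀) r) := fun z hz =>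
    ((hq z hz).comp (f := fun z => (x₀, z)) (by fun_prop)).continuousWithinAt
  obtain ⟨m, hm, hmin⟩ : ∃ m > 0, ∀ z ∈ Metric.sphere (ζ x₀) r, m ≤ ‖q (x₀, z)‖ := by
    obtain ⟨w, hw, hmin⟩ := (isCompact_sphere (ζ x₀) r).exists_isMinOn
      (NormedSpace.sphere_nonempty.2 hr.le) hq0.norm
    refine ⟨_, norm_pos_iff.2 (div_ne_zero (fun h => hsph hw ?_) (hsph hw)), hmin⟩
    exact sub_eq_zero.2 (hne.self_of_nhds w (Metric.sphere_subset_closedBall hw) h)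
  have hclose : ∀ᶠ x in 𝓝 x₀, ∀ z ∈ Metric.sphere (ζ x₀) r, ‖q (x, z) - q (x₀, z)‖ < m / 3 := by
    refine (isCompact_sphere (ζ x₀) r).eventually_forall_of_forall_eventually fun z hz => ?_
    have h1 : ContinuousAt (fun p : X × ℂ => q p - q (x₀, p.2)) (x₀, z) :=
      (hq z hz).sub (ContinuousAt.comp (g := q) (f := fun p : X × ℂ => (x₀, p.2)) (hq z hz)
        (by fun_prop))
    have h2 := h1.norm
    exact h2.eventually_lt_const (by simpa using by positivity)
  have hd0 := hd.self_of_nhds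
  have hz0 := hz.self_of_nhds
  filter_upwards [hd, hz, hne, hclose, hζ (Metric.ball_mem_nhds _ hr)] with x hd hz' hne hclose hx
  by_contra hder
  have hball : Metric.ball (ζ x₀) r ⊆ D := Metric.ball_subset_closedBall.trans hrD
  have hdiff {y : X} (hd : DifferentiableOn ℂ (N y) D) (hy : ζ y ∈ Metric.ball (ζ x₀) r) :
      DiffContOnCl ℂ (dslope (N y) (ζ y)) (Metric.ball (ζ x₀) r) := by
    refine DifferentiableOn.diffContOnCl ?_
    rw [closure_ball _ hr.ne']
    exact ((Complex.differentiableOn_dslope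
      (Filter.mem_of_superset (Metric.isOpen_ball.mem_nhds hy) hball)).2 hd).mono hrD
  have hsl {y : X} (hy : N y (ζ y) = 0) (hy' : ζ y ∈ Metric.ball (ζ x₀) r) {z : ℂ}
      (hz : z ∈ Metric.sphere (ζ x₀) r) : dslope (N y) (ζ y) z = q (y, z) := by
    have : z ≠ ζ y := by
      rintro rfl
      exact (ne_of_lt (Metric.mem_ball.1 hy')) hz
    rw [dslope_of_ne _ this, slope_def_field, hy, sub_zero]
  have hx0 : ζ x₀ ∈ Metric.ball (ζ x₀) r := Metric.mem_ball_self hr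
  have hdx := hdiff hd hx
  have hd0' := hdiff hd0 hx0
  -- If the zero were simple at x, dividing it out would leave no zero in the disc. The maximum
  -- principle for the inverse then bounds the quotient at the centre below by 2m / 3, whereas the
  -- quotient for x₀ vanishes there and the two differ by at most m / 3.
  have hnz (z : ℂ) (hz : z ∈ closure (Metric.ball (ζ x₀) r)) : dslope (N x) (ζ x) z ≠ 0 := by
    rw [closure_ball _ hr.ne'] at hz
    intro h
    by_cases hzx : z = ζ x
    · rw [hzx, dslope_same] at h; exact hder h
    · rw [dslope_of_ne _ hzx, slope_def_field, hz', sub_zero, div_eq_zero_iff] at h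
      exact hzx (h.elim (hne z hz) sub_eq_zero.1)
  have hmem : ζ x₀ ∈ closure (Metric.ball (ζ x₀) r) := subset_closure hx0
  have hb : Bornology.IsBounded (Metric.ball (ζ x₀) r) := Metric.isBounded_ball
  have h1 : ‖(dslope (N x) (ζ x))⁻¹ (ζ x₀)‖ ≤ (2 * m / 3)⁻¹ := by
    refine Complex.norm_le_of_forall_mem_frontier_norm_le hb (hdx.inv hnz) (fun z hz => ?_) hmem
    rw [frontier_ball _ hr.ne'] at hz
    rw [Pi.inv_apply, norm_inv, hsl hz' hx hz]
    refine inv_anti₀ (by positivity) ?_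
    have e1 := hmin z hz
    have e2 := hclose z hz
    have e3 := norm_sub_norm_le (q (x₀, z)) (q (x, z))
    rw [norm_sub_rev] at e3
    linarith
  have h2 : ‖(dslope (N x) (ζ x) - dslope (N x₀) (ζ x₀)) (ζ x₀)‖ ≤ m / 3 := by
    refine Complex.norm_le_of_forall_mem_frontier_norm_le hb (hdx.sub hd0') (fun z hz => ?_) hmem
    rw [frontier_ball _ hr.ne'] at hz
    rw [Pi.sub_apply, hsl hz' hx hz, hsl hz0 hx0 hz]
    exact (hclose z hz).le
  rw [Pi.sub_apply, dslope_same, h0, sub_zero] at h2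
  rw [Pi.inv_apply, norm_inv] at h1
  have h3 := (inv_le_inv₀ (norm_pos_iff.2 (hnz _ hmem)) (by positivity)).1 h1
  linarith

namespace Octonion
noncomputable section

/-! ### Injective slice regular functions have no singular points -/

/-- The first quaternionic imaginary unit. -/
def quaternionI : ℍ[ℝ] := ⟨0, 1, 0, 0⟩

/-- The second quaternionic imaginary unit. -/
def quaternionJ : ℍ[ℝ] := ⟨0, 0, 1, 0⟩

@[simp] theorem re_quaternionI : quaternionI.re = 0 := rfl
@[simp] theorem imI_quaternionI : quaternionI.imI = 1 := rfl
@[simp] theorem imJ_quaternionI : quaternionI.imJ = 0 := rfl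
@[simp] theorem imK_quaternionI : quaternionI.imK = 0 := rfl
@[simp] theorem re_quaternionJ : quaternionJ.re = 0 := rfl
@[simp] theorem imI_quaternionJ : quaternionJ.imI = 0 := rfl
@[simp] theorem imJ_quaternionJ : quaternionJ.imJ = 1 := rfl
@[simp] theorem imK_quaternionJ : quaternionJ.imK = 0 := rfl

/-! ### Two slices meeting only in ℝ, and open patches of the sphere of imaginary units. -/

theorem mk_quaternionI_mem : mk quaternionI 0 ∈ imaginaryUnits := by
  change _ = _
  ext <;> simp

theorem mk_quaternionJ_mem : mk quaternionJ 0 ∈ imaginaryUnits := by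
  change _ = _
  ext <;> simp

theorem mem_realAxis_of_mem_slices {x : Octonion} (h1 : x ∈ slice (mk quaternionI 0))
    (h2 : x ∈ slice (mk quaternionJ 0)) : x ∈ realAxis := by
  obtain ⟨a, b, rfl⟩ := Submodule.mem_span_pair.1 h1
  obtain ⟨c, d, h⟩ := Submodule.mem_span_pair.1 h2
  have hb : b = 0 := by simpa using (congrArg (fun x => x.fst.imI) h).symm
  rw [hb, zero_smul, add_zero]
  exact Submodule.smul_mem _ _ (Submodule.mem_span_singleton_self _)

theorem exists_mem_slice_orthogonal_ne_zero (J : Octonion) : ∃ v ∈ (slice J)ᗮ, v ≠ 0 := by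
  by_contra! h
  have h1 : slice J = ⊤ :=
    (Submodule.orthogonal_eq_bot_iff).1 ((Submodule.eq_bot_iff _).2 h)
  -- A slice is commutative, whereas the octonions are not.
  have h2 (x y : Octonion) : x * y = y * x := by
    obtain ⟨r, s, rfl⟩ := Submodule.mem_span_pair.1 (h1 ▸ Submodule.mem_top : x ∈ slice J)
    obtain ⟨t, u, rfl⟩ := Submodule.mem_span_pair.1 (h1 ▸ Submodule.mem_top : y ∈ slice J)
    simp only [mul_add, add_mul, smul_mul_assoc, mul_smul_comm, mul_one, one_mul]
    module
  have h3 := congrArg (fun x => x.fst.imK) (h2 (mk quaternionI 0) (mk quaternionJ 0))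
  norm_num at h3

theorem im_ne_zero_of_mem {J : Octonion} (hJ : J ∈ imaginaryUnits) : im J ≠ 0 := by
  rw [im_eq, (mem_imaginaryUnits.1 hJ).1, zero_smul, sub_zero]
  exact ne_zero_of_mem_imaginaryUnits hJ

theorem unit_of_mem {J : Octonion} (hJ : J ∈ imaginaryUnits) : unit J = J := by
  rw [unit, im_eq, (mem_imaginaryUnits.1 hJ).1, zero_smul, sub_zero, (mem_imaginaryUnits.1 hJ).2]
  simp

theorem eventually_im_ne_zero {J : Octonion} (hJ : J ∈ imaginaryUnits) :
    ∀ᶠ y in 𝓝 J, im y ≠ 0 :=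
  contDiff_im.continuous.continuousAt.eventually_ne (im_ne_zero_of_mem hJ)

theorem hasFDerivAt_unit_of_mem {J : Octonion} (hJ : J ∈ imaginaryUnits) :
    HasFDerivAt unit (ContinuousLinearMap.id ℝ Octonion - sliceProj J) J := by
  have h := hasFDerivAt_unit (im_ne_zero_of_mem hJ)
  have h1 : ‖im J‖ = 1 := by
    rw [im_eq, (mem_imaginaryUnits.1 hJ).1, zero_smul, sub_zero, (mem_imaginaryUnits.1 hJ).2]
  rwa [h1, inv_one, one_smul, unit_of_mem hJ] at h

theorem not_eventually_unit_eq {J : Octonion} (hJ : J ∈ imaginaryUnits) :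
    ¬ ∀ᶠ y in 𝓝 J, unit y = J := by
  intro h
  obtain ⟨v, hv, hv0⟩ := exists_mem_slice_orthogonal_ne_zero J
  have h1 : HasFDerivAt unit (0 : Octonion →L[ℝ] Octonion) J :=
    (hasFDerivAt_const J J).congr_of_eventuallyEq h
  have h2 := congrArg (fun L : Octonion →L[ℝ] Octonion => L v)
    ((hasFDerivAt_unit_of_mem hJ).unique h1)
  simp [sliceProj_of_mem_orthogonal hv] at h2
  exact hv0 h2

/-- An affine function that vanishes on an open patch of the sphere of units vanishes on the
imaginary octonions. Its differential shows that f v = ⟨J, v⟩ f J for imaginary v. If f J ≠ 0, every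
unit in the patch would have inner product 1 with J, and the patch would be a point. -/
theorem eq_zero_of_eventually_unit {J : Octonion} (hJ : J ∈ imaginaryUnits) {κ : ℝ}
    {f : Octonion →L[ℝ] ℝ} (h : ∀ᶠ y in 𝓝 J, κ + f (unit y) = 0) :
    κ = 0 ∧ ∀ v, re v = 0 → f v = 0 := by
  have h1 : HasFDerivAt (fun y => f (unit y)) (0 : Octonion →L[ℝ] ℝ) J :=
    (hasFDerivAt_const (-κ) J).congr_of_eventuallyEq
      (h.mono fun y hy => eq_neg_of_add_eq_zero_right hy)
  have h2 := (f.hasFDerivAt.comp J (hasFDerivAt_unit_of_mem hJ)).unique h1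
  have h3 (v : Octonion) (hv : re v = 0) : f v = inner ℝ J v * f J := by
    have := congrArg (fun L : Octonion →L[ℝ] ℝ => L v) h2
    simp [sliceProj_apply, hv] at this
    linarith
  have hκ : κ + f J = 0 := by simpa [unit_of_mem hJ] using h.self_of_nhds
  have hf : f J = 0 := by
    by_contra hf
    refine not_eventually_unit_eq hJ ?_
    filter_upwards [h, eventually_im_ne_zero hJ] with y hy hy'
    obtain ⟨hr, hn⟩ := mem_imaginaryUnits.1 (unit_mem hy')
    rw [h3 _ hr] at hy
    have : inner ℝ J (unit y) = (1 : ℝ) := by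
      have : (inner ℝ J (unit y) - 1) * f J = 0 := by linarith
      linarith [(mul_eq_zero.1 this).resolve_right hf]
    exact ((inner_eq_one_iff_of_norm_eq_one (mem_imaginaryUnits.1 hJ).2 hn).1 this).symm
  refine ⟨by linarith, fun v hv => by rw [h3 v hv, hf, mul_zero]⟩

theorem eq_zero_of_forall_inner_mul {a b : Octonion} (hb : b ≠ 0)
    (h : ∀ v, inner ℝ (v * a) b = (0 : ℝ)) : a = 0 := by
  by_contra ha
  have := h (b * a⁻¹)
  rw [mul_inv_mul b ha, inner_self_eq_zero] at this
  exact hb this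

/-- If all points of a spherical neighbourhood are singular, then the derivative of the stem
function vanishes. -/
theorem eq_zero_of_eventually_singular {J b : Octonion} (hJ : J ∈ imaginaryUnits) (hb : b ≠ 0)
    {w : Octonion × Octonion}
    (h : ∀ᶠ y in 𝓝 J, inner ℝ (embedC (unit y) w) b = (0 : ℝ) ∧
      inner ℝ (unit y * embedC (unit y) w) b = (0 : ℝ)) : w = 0 := by
  -- Both conditions are affine in the unit: u ↦ ⟨w₁, b⟩ + ⟨u w₂, b⟩ and u ↦ ⟨u w₁, b⟩ − ⟨w₂, b⟩.
  -- The constant term of each supplies the real direction that the linear part of the other leaves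
  -- out.
  have h1 : ∀ᶠ y in 𝓝 J, (inner ℝ w.1 b : ℝ) + (innerSL ℝ b).comp (mulL.flip w.2) (unit y) = 0 := by
    filter_upwards [h] with y hy
    have := hy.1
    rw [embedC, inner_add_left] at this
    simpa [real_inner_comm] using this
  have h2 : ∀ᶠ y in 𝓝 J,
      -(inner ℝ w.2 b : ℝ) + (innerSL ℝ b).comp (mulL.flip w.1) (unit y) = 0 := by
    filter_upwards [h, eventually_im_ne_zero hJ] with y hy hy'
    have := hy.2
    rw [embedC, mul_add, unit_mul_mul (unit_mem hy'), inner_add_left, inner_neg_left] at this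
    simpa [real_inner_comm, add_comm] using this
  obtain ⟨e1, f1⟩ := eq_zero_of_eventually_unit hJ h1
  obtain ⟨e2, f2⟩ := eq_zero_of_eventually_unit hJ h2
  have key {a : Octonion} (ha : inner ℝ a b = (0 : ℝ))
      (hf : ∀ v, re v = 0 → (innerSL ℝ b).comp (mulL.flip a) v = 0) : a = 0 := by
    refine eq_zero_of_forall_inner_mul hb fun v => ?_
    have hv : v = re v • (1 : Octonion) + im v := by rw [im_eq]; abel
    have := hf (im v) (re_im v)
    simp only [ContinuousLinearMap.comp_apply, ContinuousLinearMap.flip_apply, mulL_apply,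
      innerSL_apply_apply] at this
    rw [hv, add_mul, smul_mul_assoc, one_mul, inner_add_left, inner_smul_left, ha,
      real_inner_comm, this]
    simp
  exact Prod.ext (key e1 f2) (key (neg_eq_zero.1 e2) f1)

end
end Octonion

/-! ### Injectivity forces the differential to be invertible. -/

namespace Octonion
noncomputable section

/-- The function `g` is induced by the holomorphic stem function `F` on `D`, and it is injective
on the open set `U` of non-real points. -/
structure IsInjectiveInduced (D : Set ℂ) (F : ℂ → Octonion × Octonion) (g : Octonion → Octonion)
    (U : Set Octonion) : Prop where
  admissible : IsAdmissible D
  stem : IsHolomorphicStem D F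
  induces : Induces D F g
  isOpen : IsOpen U
  subset : U ⊆ circularization D \ (realAxis : Set Octonion)
  injOn : Set.InjOn g U

/-- The value at `x` of the slice function induced by the derivative of `F`. -/
def stemSliceDeriv (F : ℂ → Octonion × Octonion) (x : Octonion) : Octonion :=
  embedC (unit x) (stemDeriv F (toUpper x))

namespace IsInjectiveInduced

variable {D : Set ℂ} {F : ℂ → Octonion × Octonion} {g : Octonion → Octonion} {U : Set Octonion}

theorem im_ne_zero (h : IsInjectiveInduced D F g U) {x : Octonion} (hx : x ∈ U) : im x ≠ 0 :=
  fun h0 => (h.subset hx).2 (mem_realAxis.2 h0)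

theorem unit_mem (h : IsInjectiveInduced D F g U) {x : Octonion} (hx : x ∈ U) :
    unit x ∈ imaginaryUnits :=
  Octonion.unit_mem (h.im_ne_zero hx)

theorem toUpper_mem (h : IsInjectiveInduced D F g U) {x : Octonion} (hx : x ∈ U) :
    toUpper x ∈ D :=
  Octonion.toUpper_mem h.admissible (h.subset hx).1 (h.im_ne_zero hx)

theorem toUpper_im_pos (h : IsInjectiveInduced D F g U) {x : Octonion} (hx : x ∈ U) :
    0 < (toUpper x).im :=
  norm_pos_iff.2 (h.im_ne_zero hx)

theorem apply_eq (h : IsInjectiveInduced D F g U) {x : Octonion} (hx : x ∈ U) :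
    g x = embedC (unit x) (F (toUpper x)) := by
  rw [← h.induces _ (h.unit_mem hx) _ (h.toUpper_mem hx), embed_unit_toUpper (h.im_ne_zero hx)]

theorem contDiffAt (h : IsInjectiveInduced D F g U) {x : Octonion} (hx : x ∈ U) :
    ContDiffAt ℝ ∞ g x :=
  (hasFDerivAt_of_induces h.admissible h.stem h.induces h.isOpen h.subset hx).1

theorem hasFDerivAt (h : IsInjectiveInduced D F g U) {x : Octonion} (hx : x ∈ U) :
    HasFDerivAt g (splitMul (unit x) (stemSliceDeriv F x) (‖im x‖⁻¹ • (F (toUpper x)).2)) x :=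
  (hasFDerivAt_of_induces h.admissible h.stem h.induces h.isOpen h.subset hx).2

theorem continuous_embed_left (z : ℂ) : Continuous fun J => embed J z := by
  unfold embed; fun_prop

theorem continuous_embed (J : Octonion) : Continuous (embed J) := by
  unfold embed
  exact (Complex.continuous_re.smul continuous_const).add
    (Complex.continuous_im.smul continuous_const)

/-- Close to a point of `U`, the sphere through it is contained in `U`. -/
theorem eventually_embed_unit_mem (h : IsInjectiveInduced D F g U) {x : Octonion} (hx : x ∈ U)
    {W : Set Octonion} (hW : W ∈ 𝓝 x) :
    ∀ᶠ y in 𝓝 (unit x), im y ≠ 0 ∧ embed (unit y) (toUpper x) ∈ W := by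
  have hJ := h.unit_mem hx
  refine (eventually_im_ne_zero hJ).and ?_
  have hc : ContinuousAt (fun y => embed (unit y) (toUpper x)) (unit x) :=
    (continuous_embed_left _).continuousAt.comp
      (contDiffAt_unit (im_ne_zero_of_mem hJ)).continuousAt
  refine hc ?_
  beta_reduce
  rwa [unit_of_mem hJ, embed_unit_toUpper (h.im_ne_zero hx)]

/-- Otherwise g would not depend on the unit, and would be constant on a spherical patch through x.
-/
theorem snd_ne_zero (h : IsInjectiveInduced D F g U) {x : Octonion} (hx : x ∈ U) :
    (F (toUpper x)).2 ≠ 0 := by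
  intro h0
  refine not_eventually_unit_eq (h.unit_mem hx) ?_
  filter_upwards [h.eventually_embed_unit_mem hx (h.isOpen.mem_nhds hx)] with y hy
  have hy' := Octonion.unit_mem hy.1
  have e : g (embed (unit y) (toUpper x)) = g x := by
    rw [h.apply_eq hx, h.induces _ hy' _ (h.toUpper_mem hx), embedC, embedC, h0, mul_zero,
      mul_zero]
  have e' := congrArg unit (h.injOn hy.2 hx e)
  rwa [unit_embed hy' (h.toUpper_im_pos hx)] at e'

/-- The derivative of the normal form at `x`. -/
theorem hasDerivAt_normalForm (h : IsInjectiveInduced D F g U) {x : Octonion} (hx : x ∈ U) :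
    HasDerivAt (normalForm F (g x))
      ⟨2 * inner ℝ (unit x * stemSliceDeriv F x) (F (toUpper x)).2,
        2 * inner ℝ (stemSliceDeriv F x) (F (toUpper x)).2⟩ (toUpper x) := by
  refine (h.stem.hasDerivAt_normalForm h.admissible.isOpen (h.toUpper_mem hx) (g x)).congr_deriv ?_
  have hJ := h.unit_mem hx
  have e : (F (toUpper x)).1 - g x = -(unit x * (F (toUpper x)).2) := by
    rw [h.apply_eq hx, embedC]; abel
  set A := stemDeriv F (toUpper x)
  set b := (F (toUpper x)).2
  have e1 : unit x * stemSliceDeriv F x = unit x * A.1 - A.2 := by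
    rw [stemSliceDeriv, embedC, mul_add, unit_mul_mul hJ, sub_eq_add_neg]
  rw [e, e1, stemSliceDeriv, embedC, inner_neg_left, inner_neg_left, inner_unit_mul hJ b,
    inner_unit_mul hJ b, inner_add_left, inner_sub_left, real_inner_comm (_ * A.1),
    real_inner_comm (_ * A.2), real_inner_comm A.1, real_inner_comm A.2]
  simp only [Complex.mk.injEq, neg_neg, true_and]
  ring

theorem continuous_conj : Continuous conj := by
  have : conj = fun x => (2 * re x) • (1 : Octonion) - x := by ext1 x; exact conj_eq x
  rw [this]
  exact ((continuous_const.mul contDiff_re.continuous).smul continuous_const).sub continuous_id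

theorem continuousAt_inv {b : Octonion} (hb : b ≠ 0) :
    ContinuousAt (fun b : Octonion => b⁻¹) b := by
  have : (fun b : Octonion => b⁻¹) = fun b => (‖b‖ ^ 2)⁻¹ • conj b := rfl
  rw [this]
  exact ((continuous_norm.pow 2).continuousAt.inv₀ (by simpa using hb)).smul
    continuous_conj.continuousAt

/-- Close to a point of `U`, the normal form has no zeros besides the obvious one. -/
theorem eventually_unique_zero (h : IsInjectiveInduced D F g U) {x₀ : Octonion} (hx₀ : x₀ ∈ U) :
    ∀ᶠ p : Octonion × ℂ in 𝓝 (x₀, toUpper x₀),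
      p.2 ∈ D ∧ (normalForm F (g p.1) p.2 = 0 → p.2 = toUpper p.1) := by
  have hz₀ := h.toUpper_mem hx₀
  have hF : ContinuousAt (fun p : Octonion × ℂ => F p.2) (x₀, toUpper x₀) :=
    ContinuousAt.comp (f := Prod.snd)
      (h.stem.differentiableAt h.admissible.isOpen hz₀).continuousAt continuousAt_snd
  have hg : ContinuousAt (fun p : Octonion × ℂ => g p.1) (x₀, toUpper x₀) :=
    ContinuousAt.comp (f := Prod.fst) (h.contDiffAt hx₀).continuousAt continuousAt_fst
  have hmul : Continuous fun p : Octonion × Octonion => p.1 * p.2 :=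
    mulL.isBoundedBilinearMap.continuous
  -- The only candidate for a unit J with F₁ + J F₂ = g(x). It is continuous in (x, z) and equals
  -- the unit of x₀ at the base point, so a zero z near the base point yields a point of U in the
  -- fibre of g(x), which must be x.
  have hJ : ContinuousAt (fun p : Octonion × ℂ => (g p.1 - (F p.2).1) * (F p.2).2⁻¹)
      (x₀, toUpper x₀) :=
    hmul.continuousAt.comp (f := fun p : Octonion × ℂ => (g p.1 - (F p.2).1, (F p.2).2⁻¹))
      ((hg.sub hF.fst).prodMk (ContinuousAt.comp (f := fun p : Octonion × ℂ => (F p.2).2)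
        (continuousAt_inv (h.snd_ne_zero hx₀)) hF.snd))
  have hJ₀ : (g x₀ - (F (toUpper x₀)).1) * (F (toUpper x₀)).2⁻¹ = unit x₀ := by
    rw [h.apply_eq hx₀, embedC, add_sub_cancel_left, mul_mul_inv _ (h.snd_ne_zero hx₀)]
  have hE : ContinuousAt
      (fun p : Octonion × ℂ => embed ((g p.1 - (F p.2).1) * (F p.2).2⁻¹) p.2)
      (x₀, toUpper x₀) :=
    ((Complex.continuous_re.continuousAt.comp continuousAt_snd).smul continuousAt_const).add
      ((Complex.continuous_im.continuousAt.comp continuousAt_snd).smul hJ)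
  have hEU : ∀ᶠ p : Octonion × ℂ in 𝓝 (x₀, toUpper x₀),
      embed ((g p.1 - (F p.2).1) * (F p.2).2⁻¹) p.2 ∈ U := by
    refine hE (h.isOpen.mem_nhds ?_)
    beta_reduce
    rwa [hJ₀, embed_unit_toUpper (h.im_ne_zero hx₀)]
  have h2 : ∀ᶠ p : Octonion × ℂ in 𝓝 (x₀, toUpper x₀), (F p.2).2 ≠ 0 :=
    hF.snd.eventually_ne (h.snd_ne_zero hx₀)
  have hpos : ∀ᶠ p : Octonion × ℂ in 𝓝 (x₀, toUpper x₀), 0 < p.2.im :=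
    (Complex.continuous_im.comp continuous_snd).continuousAt.eventually_const_lt
      (h.toUpper_im_pos hx₀)
  filter_upwards [hEU, h2, hpos, continuousAt_snd (h.admissible.isOpen.mem_nhds hz₀),
    continuousAt_fst (h.isOpen.mem_nhds hx₀)] with p hpU hp2 hpos hpD hp1
  refine ⟨hpD, fun hp => ?_⟩
  have hu := mem_imaginaryUnits_of_normalForm_eq_zero hp2 hp
  have e : g (embed ((g p.1 - (F p.2).1) * (F p.2).2⁻¹) p.2) = g p.1 := by
    rw [h.induces _ hu _ hpD, embedC, mul_inv_mul _ hp2]; abel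
  rw [← h.injOn hpU hp1 e, toUpper_embed hu hpos]

/-- F would be constant on a disc, so g would take equal values at two points of one slice. -/
theorem not_eventually_stemDeriv_eq_zero (h : IsInjectiveInduced D F g U) {x₀ : Octonion}
    (hx₀ : x₀ ∈ U) : ¬ ∀ᶠ x in 𝓝 x₀, stemDeriv F (toUpper x) = 0 := by
  intro h0
  have hJ := h.unit_mem hx₀
  have hpos : ∀ᶠ z in 𝓝 (toUpper x₀), 0 < z.im :=
    Complex.continuous_im.continuousAt.eventually_const_lt (h.toUpper_im_pos hx₀)
  have hc : Filter.Tendsto (embed (unit x₀)) (𝓝 (toUpper x₀)) (𝓝 x₀) := by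
    have := (continuous_embed (unit x₀)).tendsto (toUpper x₀)
    rwa [embed_unit_toUpper (h.im_ne_zero hx₀)] at this
  have h1 : ∀ᶠ z in 𝓝 (toUpper x₀), z ∈ D ∧ 0 < z.im ∧ embed (unit x₀) z ∈ U ∧
      stemDeriv F z = 0 := by
    filter_upwards [hpos, hc.eventually h0, hc.eventually (h.isOpen.mem_nhds hx₀),
      h.admissible.isOpen.mem_nhds (h.toUpper_mem hx₀)] with z hz h1 h2 h3
    rw [toUpper_embed hJ hz] at h1
    exact ⟨h3, hz, h2, h1⟩
  obtain ⟨r, hr, hball⟩ := Metric.eventually_nhds_iff_ball.1 h1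
  have hconst : ∀ z ∈ Metric.ball (toUpper x₀) r, F z = F (toUpper x₀) := by
    intro z hz
    refine Metric.isOpen_ball.is_const_of_fderiv_eq_zero (𝕜 := ℝ)
      (convex_ball (toUpper x₀) r).isPreconnected
      (fun w hw => (h.stem.differentiableAt h.admissible.isOpen
        (hball w hw).1).differentiableWithinAt) (fun w hw => ?_) hz (Metric.mem_ball_self hr)
    ext1 v
    rw [h.stem.fderiv_apply (hball w hw).1, (hball w hw).2.2.2]
    simp [mulI]
  have hz1 : toUpper x₀ + ((r / 2 : ℝ) : ℂ) ∈ Metric.ball (toUpper x₀) r := by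
    rw [mem_ball_iff_norm, add_sub_cancel_left, Complex.norm_real, Real.norm_of_nonneg (by linarith)]
    linarith
  obtain ⟨hD1, hp1, hU1, -⟩ := hball _ hz1
  have e : g (embed (unit x₀) (toUpper x₀ + ((r / 2 : ℝ) : ℂ))) = g x₀ := by
    rw [h.induces _ hJ _ hD1, hconst _ hz1, h.apply_eq hx₀]
  have e' := congrArg re (h.injOn hU1 hx₀ e)
  rw [re_embed hJ] at e'
  simp [toUpper] at e'
  exact hr.ne' e'

/-- A singular point is a multiple zero of the normal form. As injectivity keeps that zero isolated
from all others, all nearby points would be singular as well, and F' would vanish near `toUpper x₀`.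
-/
theorem inner_ne_zero (h : IsInjectiveInduced D F g U) {x₀ : Octonion} (hx₀ : x₀ ∈ U) :
    inner ℝ (stemSliceDeriv F x₀) (F (toUpper x₀)).2 ≠ (0 : ℝ) ∨
      inner ℝ (unit x₀ * stemSliceDeriv F x₀) (F (toUpper x₀)).2 ≠ (0 : ℝ) := by
  by_contra! hs
  have hU : ∀ᶠ x in 𝓝 x₀, x ∈ U := h.isOpen.mem_nhds hx₀
  have hderiv {x : Octonion} (hx : x ∈ U) : deriv (normalForm F (g x)) (toUpper x) = 0 ↔
      inner ℝ (stemSliceDeriv F x) (F (toUpper x)).2 = (0 : ℝ) ∧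
      inner ℝ (unit x * stemSliceDeriv F x) (F (toUpper x)).2 = (0 : ℝ) := by
    rw [(h.hasDerivAt_normalForm hx).deriv, Complex.ext_iff]
    simp [and_comm]
  have huniq : ∀ᶠ p : Octonion × ℂ in 𝓝 x₀ ×ˢ 𝓝 (toUpper x₀),
      p.2 ∈ D ∧ (normalForm F (g p.1) p.2 = 0 → p.2 = toUpper p.1) := by
    rw [← nhds_prod_eq]; exact h.eventually_unique_zero hx₀
  obtain ⟨P, hP, Q, hQ, hPQ⟩ := Filter.eventually_prod_iff.1 huniq
  -- One radius serves for all x near x₀, because uniqueness of the zero holds on a product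
  -- neighbourhood.
  obtain ⟨r, hr, hrQ⟩ := Metric.nhds_basis_closedBall.eventually_iff.1 hQ
  have hrD : Metric.closedBall (toUpper x₀) r ⊆ D :=
    fun z hz => (hPQ hP.self_of_nhds (hrQ hz)).1
  have hsing : ∀ᶠ x in 𝓝 x₀, deriv (normalForm F (g x)) (toUpper x) = 0 := by
    refine eventually_deriv_eq_zero_of_unique_zero (N := fun x => normalForm F (g x)) hr hrD
      (contDiffAt_toUpper (h.im_ne_zero hx₀)).continuousAt (Filter.Eventually.of_forall ?_) ?_ ?_ ?_
      ((hderiv hx₀).2 hs)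
    · exact fun x z hz => (h.stem.hasDerivAt_normalForm h.admissible.isOpen hz
        (g x)).differentiableAt.differentiableWithinAt
    · filter_upwards [hU] with x hx
      rw [h.apply_eq hx]
      exact normalForm_embedC (h.unit_mem hx) _
    · filter_upwards [hP] with x hx z hz
      exact (hPQ hx (hrQ hz)).2
    · intro z hz
      have hF : ContinuousAt (fun p : Octonion × ℂ => F p.2) (x₀, z) :=
        ContinuousAt.comp (f := Prod.snd) (h.stem.differentiableAt h.admissible.isOpen
          (hrD (Metric.sphere_subset_closedBall hz))).continuousAt continuousAt_snd
      have hg : ContinuousAt (fun p : Octonion × ℂ => g p.1) (x₀, z) :=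
        ContinuousAt.comp (f := Prod.fst) (h.contDiffAt hx₀).continuousAt continuousAt_fst
      have e : (fun p : Octonion × ℂ => normalForm F (g p.1) p.2) = fun p =>
          ((‖(F p.2).1 - g p.1‖ ^ 2 - ‖(F p.2).2‖ ^ 2 : ℝ) : ℂ) +
          ((2 * inner ℝ ((F p.2).1 - g p.1) (F p.2).2 : ℝ) : ℂ) * Complex.I := by
        ext1 p
        rw [normalForm, Complex.mk_eq_add_mul_I]
      change ContinuousAt (fun p : Octonion × ℂ => normalForm F (g p.1) p.2) (x₀, z)
      rw [e]
      exact (Complex.continuous_ofReal.continuousAt.comp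
        (((hF.fst.sub hg).norm.pow 2).sub (hF.snd.norm.pow 2))).add
        ((Complex.continuous_ofReal.continuousAt.comp
          (continuousAt_const.mul ((hF.fst.sub hg).inner hF.snd))).mul continuousAt_const)
  refine h.not_eventually_stemDeriv_eq_zero hx₀ ?_
  -- Singularity is needed on a neighbourhood of each x, so that it applies to a patch of the sphere
  -- through x, where z is fixed and only the unit varies.
  filter_upwards [(hsing.and hU).eventually_nhds, hU] with x hx hxU
  refine eq_zero_of_eventually_singular (h.unit_mem hxU) (h.snd_ne_zero hxU) ?_
  filter_upwards [h.eventually_embed_unit_mem hxU hx] with y ⟨hy, hy'⟩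
  have := (hderiv hy'.2).1 hy'.1
  rwa [stemSliceDeriv, unit_embed (Octonion.unit_mem hy) (h.toUpper_im_pos hxU),
    toUpper_embed (Octonion.unit_mem hy) (h.toUpper_im_pos hxU)] at this

theorem isInvertible (h : IsInjectiveInduced D F g U) {x : Octonion} (hx : x ∈ U) :
    (fderiv ℝ g x).IsInvertible := by
  have hn : ‖im x‖⁻¹ ≠ 0 := inv_ne_zero (norm_ne_zero_iff.2 (h.im_ne_zero hx))
  rw [(h.hasFDerivAt hx).fderiv]
  have hinj := splitMul_injective (a := stemSliceDeriv F x) (b := ‖im x‖⁻¹ • (F (toUpper x)).2)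
    (h.unit_mem hx) (smul_ne_zero hn (h.snd_ne_zero hx)) (by
      simpa only [inner_smul_right, ne_eq, mul_eq_zero, hn, false_or] using h.inner_ne_zero hx)
  exact ⟨(LinearEquiv.ofInjectiveEndo _ hinj).toContinuousLinearEquiv, by ext1 v; rfl⟩

end IsInjectiveInduced

end
end Octonion

namespace Octonion
noncomputable section

/-! ### The push-forward of the standard almost-complex structure -/

theorem norm_inv_eq (b : Octonion) : ‖b⁻¹‖ = ‖b‖⁻¹ := by
  by_cases hb : b = 0
  · simp [inv_eq, hb]
  have := congrArg norm (mul_inv_mul 1 hb)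
  rw [one_mul, norm_mul_eq, norm_one] at this
  exact eq_inv_of_mul_eq_one_left this

/-- The structure that `splitMul J a b` transports from left multiplication by `J` is orthogonal
exactly when `J`, `a`, `b` associate. -/
theorem inner_splitMul_eq_iff {J a b : Octonion} (hJ : J ∈ imaginaryUnits) (hb : b ≠ 0) :
    (∀ u v, inner ℝ (splitMul J a b (J * u)) (splitMul J a b (J * v)) =
      (inner ℝ (splitMul J a b u) (splitMul J a b v) : ℝ)) ↔ associator J a b = 0 := by
  rw [← associator_mul_inv_eq_zero_iff hb, associator_apply, mul_inv_mul a hb]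
  have one_mem : (1 : Octonion) ∈ slice J := Submodule.subset_span (by simp)
  constructor
  · intro h
    set w := a * b⁻¹ with hw
    set w₁ := sliceProj J w with hw₁
    have m₁ : w₁ ∈ slice J := sliceProj_mem J w
    have m₂ : w - w₁ ∈ (slice J)ᗮ := sub_sliceProj_mem hJ w
    set w₂ := w - w₁ with hw₂
    have hww : w = w₁ + w₂ := by rw [hw₂]; abel
    -- Since a = w₁b + w₂b and J passes through the slice part w₁, only w₂ can obstruct
    -- associativity; testing the hypothesis on the pair 1, w₂ suffices.
    have ha : a = w * b := (mul_inv_mul a hb).symm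
    have h1 := h 1 w₂
    rw [mul_one, splitMul_of_mem hJ _ _ one_mem,
      splitMul_of_mem hJ _ _ (Submodule.subset_span (by simp)),
      splitMul_of_mem_orthogonal _ _ m₂,
      splitMul_of_mem_orthogonal _ _ (unit_mul_mem_slice_orthogonal hJ m₂), one_mul] at h1
    have h2 : inner ℝ w₁ w₂ = (0 : ℝ) := Submodule.inner_right_of_mem_orthogonal m₁ m₂
    have h3 : J * a = (J * w₁) * b + J * (w₂ * b) := by
      rw [ha, hww, add_mul, mul_add, unit_mul_slice_mul hJ m₁]
    rw [h3, inner_add_left, inner_mul_mul_right, inner_unit_mul_mul hJ, h2, ha,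
      inner_mul_mul_right, hww, inner_add_left, h2] at h1
    -- Equality in Cauchy-Schwarz: both vectors have norm ‖w₂‖‖b‖, and by `h1` their inner product
    -- is the square of this.
    have h4 : J * (w₂ * b) - (J * w₂) * b = 0 := by
      rw [← norm_eq_zero, ← sq_eq_zero_iff, norm_sub_sq_real, norm_mul_eq, norm_mul_eq,
        norm_mul_eq, norm_mul_eq, (mem_imaginaryUnits.1 hJ).2]
      rw [real_inner_self_eq_norm_sq] at h1
      linear_combination -2 * h1
    rw [h3, hww, mul_add, add_mul, ← neg_eq_zero, ← h4]
    abel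
  · intro h u v
    have hTa : J * a = (J * (a * b⁻¹)) * b := (sub_eq_zero.1 h).symm
    -- The transported structure is y ↦ (J(y b⁻¹))b on the whole space, and it is orthogonal because
    -- right multiplication by b is a similarity.
    have key (w : Octonion) : splitMul J a b (J * w) = (J * (splitMul J a b w * b⁻¹)) * b := by
      have hJa : J * (J * a) = (J * ((J * a) * b⁻¹)) * b := by
        rw [unit_mul_mul hJ, hTa, mul_mul_inv _ hb, unit_mul_mul hJ, neg_mul, mul_inv_mul a hb]
      have hs {u : Octonion} (hu : u ∈ slice J) :
          (J * u) * a = (J * ((u * a) * b⁻¹)) * b := by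
        rw [← unit_mul_slice_mul hJ hu]
        obtain ⟨r, s, rfl⟩ := Submodule.mem_span_pair.1 hu
        simp only [add_mul, mul_add, smul_mul_assoc, mul_smul_comm, one_mul]
        rw [← hJa, ← hTa]
      have hw : w = sliceProj J w + (w - sliceProj J w) := by abel
      have m₁ := sliceProj_mem J w
      have m₂ := sub_sliceProj_mem hJ w
      rw [hw]
      generalize sliceProj J w = p at *
      generalize w - p = q at *
      rw [mul_add, map_add, map_add, splitMul_of_mem hJ _ _ (unit_mul_mem_slice hJ m₁),
        splitMul_of_mem hJ _ _ m₁, splitMul_of_mem_orthogonal _ _ m₂,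
        splitMul_of_mem_orthogonal _ _ (unit_mul_mem_slice_orthogonal hJ m₂), hs m₁, add_mul,
        mul_add, add_mul, mul_mul_inv q hb]
    have hn : ‖b‖ ≠ 0 := by simpa using hb
    rw [key, key, inner_mul_mul_right, inner_unit_mul_mul hJ, inner_mul_mul_right, norm_inv_eq]
    field_simp

theorem associator_eq (x a b : Octonion) :
    associator x a b = ‖im x‖ • associator (unit x) a b := by
  by_cases hx : im x = 0
  · have : x = re x • (1 : Octonion) := by rwa [im_eq, sub_eq_zero] at hx
    rw [hx, norm_zero, zero_smul, this, associator_smul_left, associator_apply]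
    simp
  · rw [← associator_smul_left, unit, smul_inv_smul₀ (by simpa using hx), im_eq]
    simp only [associator_apply, sub_mul, smul_mul_assoc, one_mul]
    abel

/-! ### Slices, values of stem functions, and independence of the chosen stem function. -/

theorem mem_slice_iff_im {J x : Octonion} : x ∈ slice J ↔ im x ∈ slice J := by
  have h1 : (1 : Octonion) ∈ slice J := Submodule.subset_span (by simp)
  rw [im_eq]
  exact ((slice J).sub_mem_iff_left ((slice J).smul_mem _ h1)).symm

theorem realAxis_le_slice (J : Octonion) : realAxis ≤ slice J :=
  Submodule.span_mono (by simp)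

theorem embed_mem_slice (J : Octonion) (z : ℂ) : embed J z ∈ slice J :=
  Submodule.mem_span_pair.2 ⟨_, _, rfl⟩

theorem slice_neg (J : Octonion) : slice (-J) = slice J := by
  refine le_antisymm ?_ ?_ <;> rw [slice, slice, Submodule.span_le] <;> rintro x (rfl | rfl)
  · exact Submodule.subset_span (by simp)
  · exact Submodule.neg_mem _ (Submodule.subset_span (by simp))
  · exact Submodule.subset_span (by simp)
  · rw [SetLike.mem_coe, ← Submodule.neg_mem_iff]
    exact Submodule.subset_span (by simp)

/-- If the values of the induced function at a point and its conjugate lie in the slice of `J`,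
then so do the components of the stem function. -/
theorem mem_slice_of_embedC {J : Octonion} (hJ : J ∈ imaginaryUnits) {w : Octonion × Octonion}
    (h1 : embedC J w ∈ slice J) (h2 : embedC (-J) w ∈ slice J) :
    w.1 ∈ slice J ∧ w.2 ∈ slice J := by
  have e1 : w.1 = (1 / 2 : ℝ) • (embedC J w + embedC (-J) w) := by
    simp only [embedC, neg_mul]; module
  have e2 : J * w.2 = (1 / 2 : ℝ) • (embedC J w - embedC (-J) w) := by
    simp only [embedC, neg_mul]; module
  have e3 : J * w.2 ∈ slice J := e2 ▸ (slice J).smul_mem _ ((slice J).sub_mem h1 h2)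
  refine ⟨e1 ▸ (slice J).smul_mem _ ((slice J).add_mem h1 h2), ?_⟩
  have := unit_mul_mem_slice hJ e3
  rwa [unit_mul_mul hJ, Submodule.neg_mem_iff] at this

/-- For v orthogonal to K the holomorphic coordinate along v vanishes on D, hence so does its
derivative. -/
theorem IsHolomorphicStem.stemDeriv_mem {D : Set ℂ} {F : ℂ → Octonion × Octonion}
    (hF : IsHolomorphicStem D F) (hD : IsOpen D) (K : Submodule ℝ Octonion)
    (hK : ∀ z ∈ D, (F z).1 ∈ K ∧ (F z).2 ∈ K) {z : ℂ} (hz : z ∈ D) :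
    (stemDeriv F z).1 ∈ K ∧ (stemDeriv F z).2 ∈ K := by
  rw [← K.orthogonal_orthogonal, Submodule.mem_orthogonal, Submodule.mem_orthogonal,
    ← forall₂_and]
  intro v hv
  have h1 : HasDerivAt (fun w => (⟨inner ℝ v (F w).1, inner ℝ v (F w).2⟩ : ℂ)) 0 z := by
    refine (hasDerivAt_const z (0 : ℂ)).congr_of_eventuallyEq ?_
    filter_upwards [hD.mem_nhds hz] with w hw
    rw [Submodule.inner_left_of_mem_orthogonal (hK w hw).1 hv,
      Submodule.inner_left_of_mem_orthogonal (hK w hw).2 hv]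
    rfl
  have h2 := (hF.hasDerivAt_inner hD hz v).unique h1
  exact ⟨congrArg Complex.re h2, congrArg Complex.im h2⟩

/-- The values F₁ ± J F₂ for a single J determine F. This makes the real stem function of a slice
preserving g agree on D with the chosen holomorphic one. -/
theorem stem_unique {D : Set ℂ} {F G : ℂ → Octonion × Octonion} {g : Octonion → Octonion}
    (hF : Induces D F g) (hG : Induces D G g) {z : ℂ} (hz : z ∈ D) : F z = G z := by
  have hJ := mk_quaternionI_mem
  set J := mk quaternionI 0
  have h1 := (hF J hJ z hz).symm.trans (hG J hJ z hz)
  have h2 := (hF _ (neg_mem_imaginaryUnits hJ) z hz).symm.trans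
    (hG _ (neg_mem_imaginaryUnits hJ) z hz)
  simp only [embedC, neg_mul] at h1 h2
  have e1 : (F z).1 = (G z).1 := by
    have : (2 : ℝ) • (F z).1 = (2 : ℝ) • (G z).1 := by
      have e (a c : Octonion) : (2 : ℝ) • a = (a + c) + (a + -c) := by module
      rw [e _ (J * (F z).2), h1, h2, ← e]
    exact smul_right_injective _ (two_ne_zero' ℝ) this
  rw [e1, add_right_inj] at h1
  have := mul_left_cancel₀ (ne_zero_of_mem_imaginaryUnits hJ) h1
  exact Prod.ext e1 this

theorem sliceDeriv_eq {D : Set ℂ} {g : Octonion → Octonion} (hg : IsSliceRegular D g)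
    {x : Octonion} (hx : toUpper x ∈ D) : sliceDeriv D g x = stemSliceDeriv hg.choose x := by
  rw [sliceDeriv, dif_pos hg]
  change embedC (unit x) (dz hg.choose (toUpper x)) = _
  rw [hg.choose_spec.1.dz_eq hx, stemSliceDeriv]

/-! ### Formula, smoothness and orthogonality of the push-forward; slice preserving functions. -/

namespace IsInjectiveInduced

variable {D : Set ℂ} {F : ℂ → Octonion × Octonion} {g : Octonion → Octonion} {U : Set Octonion}

theorem sphericalDeriv_eq (h : IsInjectiveInduced D F g U) {x : Octonion} (hx : x ∈ U) :
    sphericalDeriv g x = ‖im x‖⁻¹ • (F (toUpper x)).2 := by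
  have hJ := h.unit_mem hx
  have hn : ‖im x‖ ≠ 0 := norm_ne_zero_iff.2 (h.im_ne_zero hx)
  have h1 : g (conj x) = embedC (-unit x) (F (toUpper x)) := by
    rw [← h.induces _ (neg_mem_imaginaryUnits hJ) _ (h.toUpper_mem hx), embed_neg,
      ← conj_embed hJ, embed_unit_toUpper (h.im_ne_zero hx)]
  have h2 : im x = ‖im x‖ • unit x := by rw [unit, smul_inv_smul₀ hn]
  have h3 : g x - g (conj x) = im x * ((2 * ‖im x‖⁻¹) • (F (toUpper x)).2) := by
    rw [h1, h.apply_eq hx, embedC, embedC, neg_mul, h2, smul_mul_assoc, mul_smul_comm, smul_smul,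
      ← h2, mul_comm (2 : ℝ), ← mul_assoc, mul_inv_cancel₀ hn]
    module
  rw [sphericalDeriv, h3, inv_mul_mul _ (h.im_ne_zero hx), smul_smul]
  congr 1; ring

theorem sphericalDeriv_ne_zero (h : IsInjectiveInduced D F g U) {x : Octonion} (hx : x ∈ U) :
    sphericalDeriv g x ≠ 0 := by
  rw [h.sphericalDeriv_eq hx]
  exact smul_ne_zero (inv_ne_zero (norm_ne_zero_iff.2 (h.im_ne_zero hx))) (h.snd_ne_zero hx)

theorem fderiv_eq (h : IsInjectiveInduced D F g U) {x : Octonion} (hx : x ∈ U) :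
    fderiv ℝ g x = splitMul (unit x) (stemSliceDeriv F x) (sphericalDeriv g x) := by
  rw [(h.hasFDerivAt hx).fderiv, h.sphericalDeriv_eq hx]

theorem invFunOn_apply (h : IsInjectiveInduced D F g U) {x : Octonion} (hx : x ∈ U) :
    Function.invFunOn g U (g x) = x :=
  h.injOn.leftInvOn_invFunOn hx

theorem pushForward_eq (h : IsInjectiveInduced D F g U) {x : Octonion} (hx : x ∈ U) :
    pushForward g U (g x) = (fderiv ℝ g x).comp ((stdJ x).comp (fderiv ℝ g x).inverse) := by
  simp only [pushForward, h.invFunOn_apply hx]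

theorem pushForward_fderiv (h : IsInjectiveInduced D F g U) {x : Octonion} (hx : x ∈ U)
    (v : Octonion) :
    pushForward g U (g x) (fderiv ℝ g x v) = fderiv ℝ g x (unit x * v) := by
  rw [h.pushForward_eq hx]
  simp [(h.isInvertible hx).inverse_apply_self, stdJ_apply]

theorem exists_fderiv_eq (h : IsInjectiveInduced D F g U) {x : Octonion} (hx : x ∈ U)
    (w : Octonion) : ∃ v, fderiv ℝ g x v = w :=
  ⟨_, (h.isInvertible hx).self_apply_inverse w⟩

/-- The invertible differential carries the orthogonal splitting along the slice to this one. -/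
theorem isCompl_map (h : IsInjectiveInduced D F g U) {x : Octonion} (hx : x ∈ U) :
    IsCompl ((slice (unit x)).map (LinearMap.mulRight ℝ (stemSliceDeriv F x)))
      ((slice (unit x))ᗮ.map (LinearMap.mulRight ℝ (sphericalDeriv g x))) := by
  obtain ⟨e, he⟩ := h.isInvertible hx
  have he' (v : Octonion) : e v =
      splitMul (unit x) (stemSliceDeriv F x) (sphericalDeriv g x) v := by
    rw [← h.fderiv_eq hx, ← he]; rfl
  have e1 : (slice (unit x)).map (LinearMap.mulRight ℝ (stemSliceDeriv F x)) =
      (slice (unit x)).map (e.toLinearEquiv : Octonion →ₗ[ℝ] Octonion) := by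
    ext w
    simp only [Submodule.mem_map]
    refine exists_congr fun v => and_congr_right fun hv => ?_
    change _ ↔ e v = w
    rw [he', splitMul_of_mem (h.unit_mem hx) _ _ hv, LinearMap.mulRight_apply]
  have e2 : (slice (unit x))ᗮ.map (LinearMap.mulRight ℝ (sphericalDeriv g x)) =
      (slice (unit x))ᗮ.map (e.toLinearEquiv : Octonion →ₗ[ℝ] Octonion) := by
    ext w
    simp only [Submodule.mem_map]
    refine exists_congr fun v => and_congr_right fun hv => ?_
    change _ ↔ e v = w
    rw [he', splitMul_of_mem_orthogonal _ _ hv, LinearMap.mulRight_apply]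
  rw [e1, e2]
  exact (Submodule.orderIsoMapComap e.toLinearEquiv).isCompl
    (Submodule.isCompl_orthogonal (K := slice (unit x)))

theorem pushForward_add (h : IsInjectiveInduced D F g U) {x : Octonion} (hx : x ∈ U)
    {p q : Octonion}
    (hp : p ∈ (slice (unit x)).map (LinearMap.mulRight ℝ (stemSliceDeriv F x)))
    (hq : q ∈ (slice (unit x))ᗮ.map (LinearMap.mulRight ℝ (sphericalDeriv g x))) :
    pushForward g U (g x) (p + q) =
      unit x * p + (unit x * (q * (sphericalDeriv g x)⁻¹)) * sphericalDeriv g x := by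
  have hJ := h.unit_mem hx
  obtain ⟨u, hu, rfl⟩ := hp
  obtain ⟨v, hv, rfl⟩ := hq
  have e : LinearMap.mulRight ℝ (stemSliceDeriv F x) u +
      LinearMap.mulRight ℝ (sphericalDeriv g x) v = fderiv ℝ g x (u + v) := by
    rw [map_add, h.fderiv_eq hx, splitMul_of_mem hJ _ _ hu, splitMul_of_mem_orthogonal _ _ hv]
    rfl
  rw [e, h.pushForward_fderiv hx, mul_add, map_add, h.fderiv_eq hx,
    splitMul_of_mem hJ _ _ (unit_mul_mem_slice hJ hu),
    splitMul_of_mem_orthogonal _ _ (unit_mul_mem_slice_orthogonal hJ hv),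
    LinearMap.mulRight_apply, LinearMap.mulRight_apply, unit_mul_slice_mul hJ hu,
    mul_mul_inv _ (h.sphericalDeriv_ne_zero hx)]

theorem isAlmostComplexStructure_stdJ (h : IsInjectiveInduced D F g U) :
    IsAlmostComplexStructure U stdJ where
  isOpen := h.isOpen
  smooth := fun x hx => (contDiffAt_stdJ (h.im_ne_zero hx)).contDiffWithinAt
  sq := fun x hx v => by rw [stdJ_apply, stdJ_apply, unit_mul_mul (h.unit_mem hx)]

theorem isOpen_image (h : IsInjectiveInduced D F g U) : IsOpen (g '' U) := by
  rw [isOpen_iff_mem_nhds]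
  rintro _ ⟨x, hx, rfl⟩
  obtain ⟨e, he⟩ := h.isInvertible hx
  have hs : HasStrictFDerivAt g (e : Octonion →L[ℝ] Octonion) x := by
    rw [he]; exact (h.contDiffAt hx).hasStrictFDerivAt (by simp)
  rw [← hs.map_nhds_eq_of_equiv]
  exact Filter.image_mem_map (h.isOpen.mem_nhds hx)

theorem contDiffAt_pushForward (h : IsInjectiveInduced D F g U) {x : Octonion} (hx : x ∈ U) :
    ContDiffAt ℝ ∞ (pushForward g U) (g x) := by
  obtain ⟨e, he⟩ := h.isInvertible hx
  have hc := h.contDiffAt hx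
  have hn : (∞ : WithTop ℕ∞) ≠ 0 := by simp
  have hs : HasFDerivAt g (e : Octonion →L[ℝ] Octonion) x := by
    rw [he]; exact (hc.differentiableAt hn).hasFDerivAt
  -- By injectivity the global inverse is a left inverse near x, so it coincides near g(x) with the
  -- smooth local inverse.
  have hinv : ContDiffAt ℝ ∞ (Function.invFunOn g U) (g x) := by
    refine (hc.to_localInverse hs hn).congr_of_eventuallyEq ?_
    refine (hc.hasStrictFDerivAt' hs hn).localInverse_unique ?_
    filter_upwards [h.isOpen.mem_nhds hx] with y hy using h.invFunOn_apply hy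
  have hfd : ContDiffAt ℝ ∞ (fderiv ℝ g) x := hc.fderiv_right (by simp)
  have hfi : ContDiffAt ℝ ∞ (fun y => (fderiv ℝ g y).inverse) x :=
    (h.isInvertible hx).contDiffAt_map_inverse.comp x hfd
  have hP : ContDiffAt ℝ ∞
      (fun y => (fderiv ℝ g y).comp ((stdJ y).comp (fderiv ℝ g y).inverse)) x :=
    hfd.clm_comp ((contDiffAt_stdJ (h.im_ne_zero hx)).clm_comp hfi)
  rw [← h.invFunOn_apply hx] at hP
  exact hP.comp (g x) hinv

theorem isAlmostComplexStructure_pushForward (h : IsInjectiveInduced D F g U) :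
    IsAlmostComplexStructure (g '' U) (pushForward g U) where
  isOpen := h.isOpen_image
  smooth := by
    rintro _ ⟨x, hx, rfl⟩
    exact (h.contDiffAt_pushForward hx).contDiffWithinAt
  sq := by
    rintro _ ⟨x, hx, rfl⟩ w
    obtain ⟨v, rfl⟩ := h.exists_fderiv_eq hx w
    rw [h.pushForward_fderiv hx, h.pushForward_fderiv hx, unit_mul_mul (h.unit_mem hx), map_neg]

theorem isHolomorphicMap (h : IsInjectiveInduced D F g U) :
    IsHolomorphicMap U (g '' U) stdJ (pushForward g U) g where
  mapsTo := Set.mapsTo_image g U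
  smooth := fun _ hx => (h.contDiffAt hx).contDiffWithinAt
  comm := fun x hx v => by rw [h.pushForward_fderiv hx, stdJ_apply]

theorem isOrthogonal_iff (h : IsInjectiveInduced D F g U) :
    IsOrthogonal (g '' U) (pushForward g U) ↔
      ∀ x ∈ U, associator x (stemSliceDeriv F x) (sphericalDeriv g x) = 0 := by
  rw [IsOrthogonal, Set.forall_mem_image]
  refine forall₂_congr fun x hx => ?_
  rw [associator_eq, smul_eq_zero_iff_right (norm_ne_zero_iff.2 (h.im_ne_zero hx)),
    ← inner_splitMul_eq_iff (h.unit_mem hx) (h.sphericalDeriv_ne_zero hx)]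
  have hf := h.fderiv_eq hx
  have hp := h.pushForward_fderiv hx
  rw [hf] at hp
  constructor
  · intro H u v
    rw [← hp, ← hp, H]
  · intro H u v
    obtain ⟨u, rfl⟩ := h.exists_fderiv_eq hx u
    obtain ⟨v, rfl⟩ := h.exists_fderiv_eq hx v
    rw [hf, hp, hp, H]

theorem associator_eq_zero (h : IsInjectiveInduced D F g U) {J : Octonion}
    (hJ : J ∈ imaginaryUnits)
    (hg : Set.MapsTo g (circularization D ∩ slice J) (slice J)) {x : Octonion} (hx : x ∈ U) :
    associator x (stemSliceDeriv F x) (sphericalDeriv g x) = 0 := by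
  have hF (z : ℂ) (hz : z ∈ D) : (F z).1 ∈ slice J ∧ (F z).2 ∈ slice J := by
    have hJ' := neg_mem_imaginaryUnits hJ
    refine mem_slice_of_embedC hJ ?_ ?_
    · rw [← h.induces J hJ z hz]
      exact hg ⟨⟨J, hJ, z, hz, rfl⟩, embed_mem_slice J z⟩
    · rw [← h.induces _ hJ' z hz]
      exact hg ⟨⟨_, hJ', z, hz, rfl⟩, by rw [← slice_neg]; exact embed_mem_slice _ z⟩
  have hz := h.toUpper_mem hx
  obtain ⟨h1, h2⟩ := h.stem.stemDeriv_mem h.admissible.isOpen _ hF hz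
  rw [associator_eq, h.sphericalDeriv_eq hx, associator_smul_right, stemSliceDeriv, embedC,
    associator_slice (h.unit_mem hx) hJ h1 h2 (hF _ hz).2, smul_zero, smul_zero]

theorem of_slicePreserving (h : IsInjectiveInduced D F g U) (hg : IsSlicePreserving D g)
    {x : Octonion} (hx : x ∈ U) :
    g x ∉ realAxis ∧ ∃ s : ℝ, s ≠ 0 ∧ sphericalDeriv g x = s • (1 : Octonion) ∧
      pushForward g U (g x) = Real.sign s • stdJ (g x) := by
  obtain ⟨G, -, hG, hGr⟩ := hg
  have hF (z : ℂ) (hz : z ∈ D) : (F z).1 ∈ realAxis ∧ (F z).2 ∈ realAxis := by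
    rw [stem_unique h.induces hG hz]; exact hGr z hz
  have hJ := h.unit_mem hx
  have hz := h.toUpper_mem hx
  have hn : 0 < ‖im x‖ := norm_pos_iff.2 (h.im_ne_zero hx)
  obtain ⟨r, hr⟩ := Submodule.mem_span_singleton.1 (hF _ hz).1
  obtain ⟨t, ht⟩ := Submodule.mem_span_singleton.1 (hF _ hz).2
  have ht0 : t ≠ 0 := by
    rintro rfl
    exact h.snd_ne_zero hx (by rw [← ht, zero_smul])
  have hgx : im (g x) = t • unit x := by
    rw [im_eq, h.apply_eq hx, embedC, ← hr, ← ht]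
    simp [(mem_imaginaryUnits.1 hJ).1]
  have hs : sphericalDeriv g x = (‖im x‖⁻¹ * t) • (1 : Octonion) := by
    rw [h.sphericalDeriv_eq hx, ← ht, smul_smul]
  -- As b is real, right multiplication by it commutes with multiplication by J; on the slice this
  -- needs no assumption on a.
  have hL (v : Octonion) : fderiv ℝ g x (unit x * v) = unit x * fderiv ℝ g x v := by
    have hv : v = sliceProj (unit x) v + (v - sliceProj (unit x) v) := by abel
    have m₁ := sliceProj_mem (unit x) v
    have m₂ := sub_sliceProj_mem hJ v
    rw [hv, h.fderiv_eq hx]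
    generalize sliceProj (unit x) v = p at *
    generalize v - p = q at *
    rw [mul_add, map_add, map_add, splitMul_of_mem hJ _ _ (unit_mul_mem_slice hJ m₁),
      splitMul_of_mem hJ _ _ m₁, splitMul_of_mem_orthogonal _ _ m₂,
      splitMul_of_mem_orthogonal _ _ (unit_mul_mem_slice_orthogonal hJ m₂), hs, mul_add,
      unit_mul_slice_mul hJ m₁]
    simp only [mul_smul_comm, mul_one]
  -- The unit of g(x) is sgn(t) times the unit of x; this sign cancels that of g'_s(x).
  have hsign : Real.sign (‖im x‖⁻¹ * t) * (|t|⁻¹ * t) = 1 := by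
    rcases lt_or_gt_of_ne ht0 with h0 | h0
    · rw [Real.sign_of_neg (mul_neg_of_pos_of_neg (inv_pos.2 hn) h0), abs_of_neg h0]
      field_simp
    · rw [Real.sign_of_pos (mul_pos (inv_pos.2 hn) h0), abs_of_pos h0]
      field_simp
  refine ⟨?_, ‖im x‖⁻¹ * t, mul_ne_zero (inv_ne_zero hn.ne') ht0, hs, ?_⟩
  · rw [mem_realAxis, hgx]
    exact smul_ne_zero ht0 (ne_zero_of_mem_imaginaryUnits hJ)
  · ext1 w
    obtain ⟨v, rfl⟩ := h.exists_fderiv_eq hx w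
    have hu : unit (g x) = (|t|⁻¹ * t) • unit x := by
      rw [unit.eq_def (g x), hgx, norm_smul, (mem_imaginaryUnits.1 hJ).2, Real.norm_eq_abs,
        mul_one, smul_smul]
    rw [h.pushForward_fderiv hx, hL, smul_apply, stdJ_apply, hu, smul_mul_assoc, smul_smul,
      hsign, one_smul]

/-- The differential sends 1 to a and J to Ja, so the hypothesis reads `unit (g x)` · a = ±Ja, and a
≠ 0 can be cancelled. -/
theorem apply_mem_slice (h : IsInjectiveInduced D F g U) {x : Octonion} (hx : x ∈ U)
    (hp : pushForward g U (g x) = stdJ (g x) ∨ pushForward g U (g x) = -stdJ (g x)) :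
    g x ∈ slice (unit x) := by
  have hJ := h.unit_mem hx
  have one_mem : (1 : Octonion) ∈ slice (unit x) := Submodule.subset_span (by simp)
  have h1 := h.pushForward_fderiv hx 1
  have ha : stemSliceDeriv F x ≠ 0 := by
    have := h.inner_ne_zero hx
    rintro h0
    simp [h0] at this
  rw [h.fderiv_eq hx, splitMul_of_mem hJ _ _ one_mem,
    splitMul_of_mem hJ _ _ (unit_mul_mem_slice hJ one_mem), one_mul, mul_one] at h1
  have h2 : unit (g x) = unit x ∨ unit (g x) = -unit x := by
    rcases hp with hp | hp
    · left
      rw [hp, stdJ_apply] at h1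
      exact mul_right_cancel₀ ha h1
    · right
      rw [hp, neg_apply, stdJ_apply, neg_eq_iff_eq_neg, ← neg_mul] at h1
      exact mul_right_cancel₀ ha h1
  have h3 : unit (g x) ∈ slice (unit x) := by
    have : unit x ∈ slice (unit x) := Submodule.subset_span (by simp)
    rcases h2 with h2 | h2 <;> rw [h2]
    · exact this
    · exact Submodule.neg_mem _ this
  rw [mem_slice_iff_im]
  by_cases h0 : im (g x) = 0
  · rw [h0]; exact Submodule.zero_mem _
  · have e : im (g x) = ‖im (g x)‖ • unit (g x) := by
      rw [unit, smul_inv_smul₀ (by simpa using h0)]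
    rw [e]
    exact Submodule.smul_mem _ _ h3

theorem isSlicePreserving (h : IsInjectiveInduced D F g U)
    (hU : U = circularization D \ (realAxis : Set Octonion))
    (hp : ∀ y ∈ g '' U, pushForward g U y = stdJ y ∨ pushForward g U y = -stdJ y) :
    IsSlicePreserving D g := by
  have hpos {z : ℂ} (hz : z ∈ D) (hz' : 0 < z.im) :
      (F z).1 ∈ realAxis ∧ (F z).2 ∈ realAxis := by
    have key {J : Octonion} (hJ : J ∈ imaginaryUnits) : embedC J (F z) ∈ slice J := by
      have hx : embed J z ∈ U := by
        rw [hU]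
        refine ⟨⟨J, hJ, z, hz, rfl⟩, fun h0 => ?_⟩
        have := mem_realAxis.1 h0
        rw [im_embed hJ] at this
        exact smul_ne_zero hz'.ne' (ne_zero_of_mem_imaginaryUnits hJ) this
      have := h.apply_mem_slice hx (hp _ ⟨_, hx, rfl⟩)
      rwa [unit_embed hJ hz', h.induces J hJ z hz] at this
    have key' {J : Octonion} (hJ : J ∈ imaginaryUnits) : (F z).1 ∈ slice J ∧ (F z).2 ∈ slice J :=
      mem_slice_of_embedC hJ (key hJ) (slice_neg J ▸ key (neg_mem_imaginaryUnits hJ))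
    exact ⟨mem_realAxis_of_mem_slices (key' mk_quaternionI_mem).1 (key' mk_quaternionJ_mem).1,
      mem_realAxis_of_mem_slices (key' mk_quaternionI_mem).2 (key' mk_quaternionJ_mem).2⟩
  refine ⟨F, h.stem.isStem, h.induces, fun z hz => ?_⟩
  rcases lt_trichotomy z.im 0 with h0 | h0 | h0
  · have hz' := h.admissible.conj_mem z hz
    have := hpos hz' (by simpa using h0)
    rw [h.stem.isStem z hz] at this
    simpa using this
  -- Real z do not correspond to points of U; they are reached as limits from the upper half plane,
  -- ℝ being closed in 𝕆.
  · have hc : Filter.Tendsto (fun t : ℝ => z + t * Complex.I) (𝓝[>] 0) (𝓝 z) := by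
      have : Continuous fun t : ℝ => z + t * Complex.I := by fun_prop
      simpa using (this.tendsto 0).mono_left nhdsWithin_le_nhds
    have hev : ∀ᶠ t : ℝ in 𝓝[>] 0, z + t * Complex.I ∈ D ∧ 0 < (z + t * Complex.I).im := by
      filter_upwards [hc (h.admissible.isOpen.mem_nhds hz), self_mem_nhdsWithin] with t ht ht'
      exact ⟨ht, by simpa [h0] using ht'⟩
    have hF := ((h.stem.differentiableAt h.admissible.isOpen hz).continuousAt.tendsto).comp hc
    have hcl : IsClosed (realAxis : Set Octonion) := Submodule.closed_of_finiteDimensional _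
    exact ⟨hcl.mem_of_tendsto ((continuous_fst.tendsto _).comp hF)
        (hev.mono fun t ht => (hpos ht.1 ht.2).1),
      hcl.mem_of_tendsto ((continuous_snd.tendsto _).comp hF)
        (hev.mono fun t ht => (hpos ht.1 ht.2).2)⟩
  · exact hpos hz h0

end IsInjectiveInduced

end
end Octonion

/-! ### The main theorem. -/

open Octonion
theorem mainTheorem12 (D : Set ℂ) (hD : IsAdmissible D)
    (g : Octonion → Octonion) (hg : IsSliceRegular D g) (hgc : ¬ IsSliceConstant D g)
    (U : Set Octonion) (hU : IsOpen U) (hUD : U ⊆ circularization D \ (realAxis : Set Octonion))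
    (hinj : Set.InjOn g U) :
    -- the push-forward is well defined on `g '' U`
    (∀ x ∈ U, DifferentiableAt ℝ g x ∧ (fderiv ℝ g x).IsInvertible ∧
      pushForward g U (g x) = (fderiv ℝ g x).comp ((stdJ x).comp (fderiv ℝ g x).inverse)) ∧
    -- the explicit formula, and the splitting of the tangent space it refers to
    (∀ J ∈ imaginaryUnits, ∀ α β : ℝ, 0 < β → ∀ x ∈ U, x = α • (1 : Octonion) + β • J →
      sphericalDeriv g x ≠ 0 ∧
      IsCompl ((slice J).map (LinearMap.mulRight ℝ (sliceDeriv D g x)))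
        ((slice J)ᗮ.map (LinearMap.mulRight ℝ (sphericalDeriv g x))) ∧
      ∀ p ∈ (slice J).map (LinearMap.mulRight ℝ (sliceDeriv D g x)),
      ∀ q ∈ (slice J)ᗮ.map (LinearMap.mulRight ℝ (sphericalDeriv g x)),
        pushForward g U (g x) (p + q) =
          J * p + (J * (q * (sphericalDeriv g x)⁻¹)) * sphericalDeriv g x) ∧
    -- it is an almost-complex structure, and `g` is holomorphic
    IsAlmostComplexStructure U stdJ ∧
    IsAlmostComplexStructure (g '' U) (pushForward g U) ∧
    IsHolomorphicMap U (g '' U) stdJ (pushForward g U) g ∧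
    -- orthogonality
    (IsOrthogonal (g '' U) (pushForward g U) ↔
      ∀ x ∈ U, associator x (sliceDeriv D g x) (sphericalDeriv g x) = 0) ∧
    ((∃ J ∈ imaginaryUnits, Set.MapsTo g (circularization D ∩ slice J) (slice J)) →
      ∀ x ∈ U, associator x (sliceDeriv D g x) (sphericalDeriv g x) = 0) ∧
    -- slice preserving functions
    (IsSlicePreserving D g →
      Disjoint (g '' U) (realAxis : Set Octonion) ∧
      ∀ x ∈ U, ∃ s : ℝ, s ≠ 0 ∧ sphericalDeriv g x = s • (1 : Octonion) ∧
        pushForward g U (g x) = Real.sign s • stdJ (g x)) ∧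
    (U = circularization D \ (realAxis : Set Octonion) →
      Disjoint (g '' U) (realAxis : Set Octonion) →
      (∀ y ∈ g '' U, pushForward g U y = stdJ y ∨ pushForward g U y = -stdJ y) →
      IsSlicePreserving D g) := by
  have h : IsInjectiveInduced D hg.choose g U :=
    ⟨hD, hg.choose_spec.1, hg.choose_spec.2, hU, hUD, hinj⟩
  have hsd {x : Octonion} (hx : x ∈ U) : sliceDeriv D g x = stemSliceDeriv hg.choose x :=
    sliceDeriv_eq hg (h.toUpper_mem hx)
  have hassoc : (∀ x ∈ U, associator x (sliceDeriv D g x) (sphericalDeriv g x) = 0) ↔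
      ∀ x ∈ U, associator x (stemSliceDeriv hg.choose x) (sphericalDeriv g x) = 0 :=
    forall₂_congr fun x hx => by rw [hsd hx]
  refine ⟨fun x hx => ⟨(h.hasFDerivAt hx).differentiableAt, h.isInvertible hx,
    h.pushForward_eq hx⟩, ?_, h.isAlmostComplexStructure_stdJ,
    h.isAlmostComplexStructure_pushForward, h.isHolomorphicMap,
    h.isOrthogonal_iff.trans hassoc.symm,
    fun ⟨J, hJ, hgJ⟩ => hassoc.2 fun x hx => h.associator_eq_zero hJ hgJ hx,
    fun hsp => ⟨?_, fun x hx => (h.of_slicePreserving hsp hx).2⟩,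
    fun hUeq _ hp => h.isSlicePreserving hUeq hp⟩
  · intro J hJ α β hβ x hx hxJ
    have hJx : unit x = J := by
      rw [hxJ]; exact unit_embed hJ (z := ⟨α, β⟩) hβ
    rw [hsd hx, ← hJx]
    exact ⟨h.sphericalDeriv_ne_zero hx, h.isCompl_map hx,
      fun p hp q hq => h.pushForward_add hx hp hq⟩
  · rw [Set.disjoint_left]
    rintro _ ⟨x, hx, rfl⟩
    exact (h.of_slicePreserving hsp hx).1
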